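/- **Conventions.** A hypercomplex manifold $(M,I,J,K)$ is a smooth manifold with three integrable complex structures acting on the right on $TM$, with $IJ=-JI=K$ (that is, $X\circ K=(X\circ I)\circ J$); unit quaternions $SU(2)$ then act on the left on complex-valued forms by $(q\eta)(X_1,\dots,X_k)=\eta(X_1\circ q,\dots,X_k\circ q)$, and $J\eta$ denotes this action for $q=J$. The types $\Lambda^{p,q}_I$ and the operators $\partial,\bar\partial$ refer to $(M,I)$, where $\eta\in\Lambda^{1,0}_I$ means $\eta(X\circ I)=\sqrt{-1}\,\eta(X)$; on functions $\partial_J=J^{-1}\circ\bar\partial$. For a quaternionic Hermitian ($SU(2)$-invariant Riemannian) metric $g$ put $\omega_L(A,B)=g(A,B\circ L)$ for $L=I,J,K$ and $\Omega=-\omega_J+\sqrt{-1}\,\omega_K\in\Lambda^{2,0}_I(M)$; $g$ is HKT if $\partial\Omega=0$. Let $\Lambda^*_+$ be the quotient of $\Lambda^*(M)$ by the ideal which in degree $k$ is the sum of all $SU(2)$-invariant subspaces of weight less than $k$. For $k=p+q$ and $\xi\in\Lambda^{p,q}_I$, let $R(\xi)\in\Lambda^{k,0}_I$ be the unique form such that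 $\xi$ and $h_1^ph_2^q\otimes R(\xi)$ have the same class in $\Lambda^k_+$, where, for a $(k,0)$-form $\eta$, $$(h_1^ph_2^q\otimes\eta)(X_1,\dots,X_k)=\frac1{k!}\sum_{\sigma}\operatorname{sgn}(\sigma)\,\eta\bigl(X_{\sigma(1)},\dots,X_{\sigma(p)},X_{\sigma(p+1)}\circ J,\dots,X_{\sigma(k)}\circ J\bigr).$$ A $(2p,0)$-form $\eta$ is q-real if $J\bar\eta=\eta$. A q-real $(2,0)$-form is q-positive if $\eta(X,X\circ J)\ge 0$ for all real $X$, and a $(2n,0)$-form is q-positive if it is pointwise a combination, with non-negative coefficients, of products of $n$ q-positive $(2,0)$-forms. For a $(2n,0)$-form $\Theta$, where $\dim_{\mathbb R}M=4n$, the operator $V:\Lambda^{2p,0}_I(M)\to\Lambda^{n+p,n+p}_I(M)$ is defined by $V(\eta)\wedge\xi=\eta\wedge R(\xi)\wedge\bar\Theta$ for all $\xi\in\Lambda^{n-p,n-p}_I(M)$. **Theorem.** Let $(M,I,J,K)$ be a hypercomplex manifold of real dimension $4n$ with an HKT-metric $g$, and let $\Theta\in\Lambda^{2n,0}_I(M)$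 be a q-real, q-positive, nowhere vanishing holomorphic form. Put $\Phi=V(1)\in\Lambda^{n,n}_I(M)$. Then for all real-valued $C^\infty$ functions $f$ and $\varphi$ on $M$, the quaternionic Monge–Ampère equation $$(\Omega+\partial\partial_J\varphi)^n=e^f\,\Omega^n$$ holds on $M$ if and only if the complex Hessian equation $$(\omega_I-\sqrt{-1}\,\partial\bar\partial\varphi)^n\wedge\Phi=e^f\,\omega_I^n\wedge\Phi$$ holds on $M$. -/

import Mathlib

open scoped Manifold ContDiff

noncomputable section

namespace HKT

/-! ### Linear algebra of complex-valued forms on one (tangent) space -/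

section Pointwise

variable {E : Type*} [NormedAddCommGroup E] [NormedSpace ℝ E]

/-- Complex-valued alternating `k`-forms on `E`, i.e. `Λ^k (E^*) ⊗ ℂ`. -/
abbrev CForm (E : Type*) [NormedAddCommGroup E] [NormedSpace ℝ E] (k : ℕ) : Type _ :=
  E [⋀^Fin k]→L[ℝ] ℂ

/-- The (non-alternating) product
`(v₁, …, v_{k+l}) ↦ a (v₁, …, v_k) * b (v_{k+1}, …, v_{k+l})`. -/
def tensorProd {k l : ℕ} (a : CForm E k) (b : CForm E l) :
    ContinuousMultilinearMap ℝ (fun _ : Fin (k + l) => E) ℂ where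
  toMultilinearMap := (LinearMap.mul' ℝ ℂ).compMultilinearMap
    ((MultilinearMap.domCoprod a.toMultilinearMap b.toMultilinearMap).domDomCongr
      finSumFinEquiv)
  cont := by
    have h : Continuous fun v : Fin (k + l) → E =>
        a (fun i => v (Fin.castAdd l i)) * b (fun i => v (Fin.natAdd k i)) := by
      fun_prop
    exact h

theorem tensorProd_apply {k l : ℕ} (a : CForm E k) (b : CForm E l) (v : Fin (k + l) → E) :
    tensorProd a b v =
      a (fun i => v (Fin.castAdd l i)) * b (fun i => v (Fin.natAdd k i)) := rfl

/-- The wedge product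
`(a ∧ b)(v) = 1/(k! l!) ∑_σ sgn σ · a (v_{σ 1}, …, v_{σ k}) b (v_{σ (k+1)}, …)`. -/
def wedge {k l : ℕ} (a : CForm E k) (b : CForm E l) : CForm E (k + l) :=
  ((k.factorial : ℂ) * (l.factorial : ℂ))⁻¹ •
    ContinuousMultilinearMap.alternatization (tensorProd a b)

/-- The constant `c` as a `0`-form. -/
def const0 (E : Type*) [NormedAddCommGroup E] [NormedSpace ℝ E] (c : ℂ) : CForm E 0 :=
  ContinuousAlternatingMap.constOfIsEmpty ℝ E (Fin 0) c

/-- The power `α^m = α ∧ ⋯ ∧ α` of a `2`-form. -/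
def wpow (α : CForm E 2) : (m : ℕ) → CForm E (2 * m)
  | 0 => const0 E 1
  | m + 1 => wedge (wpow α m) α

/-- Complex conjugation of forms. -/
def conj {k : ℕ} (ξ : CForm E k) : CForm E k :=
  (Complex.conjCLE : ℂ →L[ℝ] ℂ).compContinuousAlternatingMap ξ

/-- Transport of a form along an equality of degrees. -/
def castDeg {k l : ℕ} (h : k = l) (ξ : CForm E k) : CForm E l where
  toContinuousMultilinearMap := ξ.toContinuousMultilinearMap.domDomCongr (finCongr h)
  map_eq_zero_of_eq' v i j hv hij :=
    ξ.map_eq_zero_of_eq (fun a => v (Fin.cast h a)) (i := Fin.cast h.symm i)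
      (j := Fin.cast h.symm j) (by simpa using hv) (by simpa [Fin.ext_iff] using hij)

/-- Action on forms of an endomorphism: `(A ξ)(v₁, …, v_k) = ξ (A v₁, …, A v_k)`. -/
def pull {k : ℕ} (A : E →L[ℝ] E) (ξ : CForm E k) : CForm E k :=
  ξ.compContinuousLinearMap A

/-- A right action of the quaternions on `E`, where `I v`, `J v`, `K v` stand for
`v ∘ I`, `v ∘ J`, `v ∘ K`. The relation `IJ = -JI = K` for a *right* action reads
`v ∘ K = (v ∘ I) ∘ J = -(v ∘ J) ∘ I`. -/
structure QuatStr (E : Type*) [NormedAddCommGroup E] [NormedSpace ℝ E] where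
  I : E →L[ℝ] E
  J : E →L[ℝ] E
  K : E →L[ℝ] E
  I_sq : ∀ v, I (I v) = -v
  J_sq : ∀ v, J (J v) = -v
  K_eq : ∀ v, K v = J (I v)
  anti : ∀ v, I (J v) = -J (I v)

namespace QuatStr

variable (H : QuatStr E)

theorem K_sq (v : E) : H.K (H.K v) = -v := by
  rw [H.K_eq, H.K_eq, H.anti, map_neg, H.J_sq, H.I_sq, neg_neg]

/-- `v ↦ v ∘ q` for the quaternion `q = a + b I + c J + d K`. -/
def op (a b c d : ℝ) : E →L[ℝ] E :=
  a • ContinuousLinearMap.id ℝ E + b • H.I + c • H.J + d • H.K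

/-- `v ↦ v ∘ (cos θ + sin θ I)`. -/
def rot (θ : ℝ) : E →L[ℝ] E := H.op (Real.cos θ) (Real.sin θ) 0 0

/-- `ξ` has weight `m` for the circle `{cos θ + sin θ I} ⊂ SU(2)`. -/
def HasWeight {k : ℕ} (m : ℤ) (ξ : CForm E k) : Prop :=
  ∀ θ : ℝ, pull (H.rot θ) ξ = Complex.exp (Complex.I * (m : ℂ) * (θ : ℂ)) • ξ

/-- `ξ ∈ Λ^{p,q}_I`: a `(1,0)`-form is a `1`-form with `η (v ∘ I) = √-1 η v`, and the
`(p,q)`-forms are the `(p+q)`-forms of weight `p - q`. -/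
def IsType {k : ℕ} (p q : ℕ) (ξ : CForm E k) : Prop :=
  p + q = k ∧ H.HasWeight ((p : ℤ) - (q : ℤ)) ξ

/-- The projection of a form to its component of weight `m`. On `(p+q)`-forms and for
`m = p - q` this is the projection to the `(p,q)`-component. -/
def weightProj {k : ℕ} (m : ℤ) (ξ : CForm E k) : CForm E k :=
  ((2 * Real.pi)⁻¹ : ℝ) • ∫ θ in (0 : ℝ)..(2 * Real.pi),
    Complex.exp (-(Complex.I * (m : ℂ) * (θ : ℂ))) • pull (H.rot θ) ξ

/-- The sum of all `SU(2)`-invariant subspaces of `Λ^k` all of whose weights are less than `k`.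
The algebra `Λ^*_+` is the quotient of `Λ^*` by the sum of these spaces. -/
def lowWeight (k : ℕ) : Submodule ℂ (CForm E k) :=
  sSup {W | (∀ a b c d : ℝ, a ^ 2 + b ^ 2 + c ^ 2 + d ^ 2 = 1 →
      ∀ ξ ∈ W, pull (H.op a b c d) ξ ∈ W) ∧
    ∀ (m : ℤ), ∀ ξ ∈ W, ξ ≠ 0 → H.HasWeight m ξ → m < (k : ℤ)}

/-- `h₁^p h₂^{k-p} ⊗ η` as a form, where `h₁ = 1`, `h₂ = J`: the image of
`(a₁ ⋯ a_k) ⊗ η` under `(a₁ ⋯ a_k) ⊗ (b₁ ∧ ⋯ ∧ b_k) ↦ 1/k! ∑_σ a_{σ 1} b₁ ∧ ⋯ ∧ a_{σ k} b_k`,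
with `p` of the `a_i` equal to `1` and the others equal to `J`. -/
def mix {k : ℕ} (p : ℕ) (η : CForm E k) : CForm E k :=
  ((k.factorial : ℂ))⁻¹ • ContinuousMultilinearMap.alternatization
    (η.toContinuousMultilinearMap.compContinuousLinearMap
      (fun i : Fin k => if (i : ℕ) < p then ContinuousLinearMap.id ℝ E else H.J))

/-- `η = R ξ` for `ξ ∈ Λ^{p,q}_I`, `k = p + q`: the form `η` is of type `(k,0)`, and `ξ` and
`h₁^p h₂^q ⊗ η` have the same class in `Λ^k_+`. -/
def IsR {k : ℕ} (p : ℕ) (ξ η : CForm E k) : Prop :=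
  H.IsType k 0 η ∧ ξ - H.mix p η ∈ H.lowWeight k

open Classical in
/-- The operator `R : Λ^{p,q}_I → Λ^{p+q,0}_I`. -/
def R {k : ℕ} (p : ℕ) (ξ : CForm E k) : CForm E k :=
  if h : ∃ η, H.IsR p ξ η then h.choose else 0

/-- `v = V(η)` for `η ∈ Λ^{2p,0}_I`: the form `v` is of type `(n+p,n+p)`, and
`v ∧ ξ = η ∧ R(ξ) ∧ conj Θ` for every `ξ` of type `(n-p,n-p)`. -/
def IsV {n p : ℕ} (hp : p ≤ n) (Θ : CForm E (2 * n)) (η : CForm E (2 * p))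
    (v : CForm E (2 * (n + p))) : Prop :=
  H.IsType (n + p) (n + p) v ∧
  ∀ ξ : CForm E (2 * (n - p)), H.IsType (n - p) (n - p) ξ →
    castDeg (by omega : 2 * (n + p) + 2 * (n - p) = 4 * n) (wedge v ξ) =
      castDeg (by omega : 2 * p + 2 * (n - p) + 2 * n = 4 * n)
        (wedge (wedge η (H.R (n - p) ξ)) (conj Θ))

/-- `ξ` is q-real: `J (conj ξ) = ξ`. -/
def IsQReal {k : ℕ} (ξ : CForm E k) : Prop := pull H.J (conj ξ) = ξ

/-- `η` is a q-positive `(2,0)`-form: it is q-real and `η (v, v ∘ J) ≥ 0` for real `v`. -/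
def IsQPos2 (η : CForm E 2) : Prop :=
  H.IsType 2 0 η ∧ H.IsQReal η ∧ ∀ v : E, 0 ≤ (η ![v, H.J v]).re

/-- Products of `p` q-positive `(2,0)`-forms. -/
def IsQProd : (p : ℕ) → CForm E (2 * p) → Prop
  | 0, ξ => ξ = const0 E 1
  | p + 1, ξ => ∃ (α : CForm E (2 * p)) (β : CForm E 2),
      IsQProd p α ∧ H.IsQPos2 β ∧ ξ = wedge α β

/-- The cone of (strongly) q-positive `(2p,0)`-forms: sums with non-negative coefficients of
products of q-positive `(2,0)`-forms. -/
def IsQPos (p : ℕ) (ξ : CForm E (2 * p)) : Prop :=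
  ξ ∈ Submodule.span NNReal {η : CForm E (2 * p) | H.IsQProd p η}

/-- The fundamental form `(v, w) ↦ g (v, A w)` of a bilinear form `g` and an endomorphism `A`
for which it is alternating. -/
def fundForm (g : E →L[ℝ] E →L[ℝ] ℝ) (A : E →L[ℝ] E) (h : ∀ v, g v (A v) = 0) :
    CForm E 2 where
  toFun v := ((g (v 0) (A (v 1)) : ℝ) : ℂ)
  map_update_add' m i x y := by
    fin_cases i <;> simp [Function.update]
  map_update_smul' m i c x := by
    fin_cases i <;> simp [Function.update]
  cont := by fun_prop
  map_eq_zero_of_eq' v i j hv hij := by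
    have h01 : v 0 = v 1 := by
      fin_cases i <;> fin_cases j <;> simp_all
    simp [h01, h]

end QuatStr

end Pointwise

/-! ### Differential forms on manifolds -/

section Manifold

variable {E : Type*} [NormedAddCommGroup E] [NormedSpace ℝ E]
  {M : Type*} [TopologicalSpace M] [ChartedSpace E M]

/-- Complex-valued differential `k`-forms on `M` (not assumed smooth). The tangent space
`TangentSpace 𝓘(ℝ, E) x` is by definition the model space `E`, so that a form is a family of
alternating forms on `E` indexed by the points of `M`. -/
abbrev DForm (E M : Type*) [NormedAddCommGroup E] [NormedSpace ℝ E] (k : ℕ) : Type _ :=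
  M → CForm E k

/-- The coordinate expression of a form in the chart at `x₀`: its pull-back under the inverse
of the chart. -/
def chartRep {k : ℕ} (α : DForm E M k) (x₀ : M) (y : E) : CForm E k :=
  (α ((extChartAt 𝓘(ℝ, E) x₀).symm y)).compContinuousLinearMap
    (mfderiv 𝓘(ℝ, E) 𝓘(ℝ, E) (extChartAt 𝓘(ℝ, E) x₀).symm y : E →L[ℝ] E)

/-- Smoothness of a form: all its coordinate expressions are smooth. -/
def IsSmoothForm {k : ℕ} (α : DForm E M k) : Prop :=
  ∀ x₀ : M, ContDiffOn ℝ ∞ (chartRep α x₀) (extChartAt 𝓘(ℝ, E) x₀).target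

/-- The exterior derivative, computed in the chart at `x` and pulled back to `x`. -/
def dForm {k : ℕ} (α : DForm E M k) : DForm E M (k + 1) := fun x =>
  (extDeriv (chartRep α x) (extChartAt 𝓘(ℝ, E) x x)).compContinuousLinearMap
    (mfderiv 𝓘(ℝ, E) 𝓘(ℝ, E) (extChartAt 𝓘(ℝ, E) x) x : E →L[ℝ] E)

/-- A real function as a `0`-form. -/
def ofFun (E : Type*) [NormedAddCommGroup E] [NormedSpace ℝ E] {M : Type*} (φ : M → ℝ) :
    DForm E M 0 := fun x => const0 E (φ x : ℂ)

/-- A field of endomorphisms of the tangent spaces is smooth. -/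
def IsSmoothEnd [IsManifold 𝓘(ℝ, E) ∞ M] (A : M → E →L[ℝ] E) : Prop :=
  ContMDiff 𝓘(ℝ, E) (𝓘(ℝ, E).prod 𝓘(ℝ, E →L[ℝ] E)) ∞
    (fun x : M => Bundle.TotalSpace.mk' (E →L[ℝ] E)
      (E := fun x : M => TangentSpace 𝓘(ℝ, E) x →L[ℝ] TangentSpace 𝓘(ℝ, E) x) x (A x))

/-- The Lie bracket of two vector fields at `x`, an element of `TangentSpace 𝓘(ℝ, E) x = E`. -/
def bracketAt (X Y : (y : M) → TangentSpace 𝓘(ℝ, E) y) (x : M) : E :=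
  VectorField.mlieBracket 𝓘(ℝ, E) X Y x

/-- The Nijenhuis tensor `[AX, AY] - A[AX, Y] - A[X, AY] - [X, Y]` of an almost complex
structure `A` vanishes. -/
def IsIntegrable [IsManifold 𝓘(ℝ, E) ∞ M] (A : M → E →L[ℝ] E) : Prop :=
  ∀ (x : M) (X Y : (y : M) → TangentSpace 𝓘(ℝ, E) y),
    ContMDiffAt 𝓘(ℝ, E) 𝓘(ℝ, E).tangent ∞
      (fun y => (⟨y, X y⟩ : TangentBundle 𝓘(ℝ, E) M)) x →
    ContMDiffAt 𝓘(ℝ, E) 𝓘(ℝ, E).tangent ∞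
      (fun y => (⟨y, Y y⟩ : TangentBundle 𝓘(ℝ, E) M)) x →
    bracketAt (fun y => A y (X y)) (fun y => A y (Y y)) x
      - A x (bracketAt (fun y => A y (X y)) Y x)
      - A x (bracketAt X (fun y => A y (Y y)) x) - bracketAt X Y x = 0

variable (E M) in
/-- A hypercomplex structure: three complex structures `I, J, K` (smooth integrable almost
complex structures) with `IJ = -JI = K`, acting on the right on the tangent bundle. -/
structure HypercomplexStr [IsManifold 𝓘(ℝ, E) ∞ M] where
  at_ : M → QuatStr E
  smooth_I : IsSmoothEnd fun x => (at_ x).I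
  smooth_J : IsSmoothEnd fun x => (at_ x).J
  smooth_K : IsSmoothEnd fun x => (at_ x).K
  integrable_I : IsIntegrable fun x => (at_ x).I
  integrable_J : IsIntegrable fun x => (at_ x).J
  integrable_K : IsIntegrable fun x => (at_ x).K

namespace HypercomplexStr

variable [IsManifold 𝓘(ℝ, E) ∞ M] (X : HypercomplexStr E M)

/-- `α ∈ Λ^{p,q}_I(M)`. -/
def IsType {k : ℕ} (p q : ℕ) (α : DForm E M k) : Prop := ∀ x, (X.at_ x).IsType p q (α x)

/-- `∂` on forms of type `(p,q)` on `(M, I)`: the `(p+1,q)`-component of `d`. -/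
def del (p q : ℕ) (α : DForm E M (p + q)) : DForm E M (p + q + 1) := fun x =>
  (X.at_ x).weightProj (((p + 1 : ℕ) : ℤ) - (q : ℤ)) (dForm α x)

/-- `∂̄` on forms of type `(p,q)` on `(M, I)`: the `(p,q+1)`-component of `d`. -/
def delbar (p q : ℕ) (α : DForm E M (p + q)) : DForm E M (p + q + 1) := fun x =>
  (X.at_ x).weightProj ((p : ℤ) - ((q + 1 : ℕ) : ℤ)) (dForm α x)

/-- `∂_J φ = J⁻¹ (∂̄ φ)` for a function `φ`; on vectors `J⁻¹ = -J`. -/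
def delJ (φ : M → ℝ) : DForm E M 1 := fun x =>
  pull (-(X.at_ x).J) (X.delbar 0 0 (ofFun E φ) x)

/-- `∂ ∂_J φ`. -/
def delDelJ (φ : M → ℝ) : DForm E M 2 := X.del 1 0 (X.delJ φ)

/-- `∂ ∂̄ φ`. -/
def delDelbar (φ : M → ℝ) : DForm E M 2 := X.del 0 1 (X.delbar 0 0 (ofFun E φ))

/-- `Θ` is a holomorphic `(m,0)`-form on `(M, I)`. -/
def IsHolomorphic {m : ℕ} (Θ : DForm E M m) : Prop :=
  IsSmoothForm Θ ∧ X.IsType m 0 Θ ∧ X.delbar m 0 Θ = 0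

open Classical in
/-- The operator `V : Λ^{2p,0}_I(M) → Λ^{n+p,n+p}_I(M)` defined by the `(2n,0)`-form `Θ`. -/
def V {n p : ℕ} (hp : p ≤ n) (Θ : DForm E M (2 * n)) (η : DForm E M (2 * p)) :
    DForm E M (2 * (n + p)) := fun x =>
  if h : ∃ v, (X.at_ x).IsV hp (Θ x) (η x) v then h.choose else 0

/-- `Φ = V(1)`. -/
def Phi {n : ℕ} (Θ : DForm E M (2 * n)) : DForm E M (2 * n) :=
  X.V (p := 0) (Nat.zero_le n) Θ (fun _ => const0 E 1)

end HypercomplexStr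

/-- A quaternionic Hermitian metric: a smooth Riemannian metric which is invariant under the
group of unit quaternions. -/
structure QuatHermitianMetric [IsManifold 𝓘(ℝ, E) ∞ M] (X : HypercomplexStr E M) extends
    Bundle.ContMDiffRiemannianMetric 𝓘(ℝ, E) ∞ E
      (fun x : M => TangentSpace 𝓘(ℝ, E) x) where
  invariant : ∀ (x : M) (a b c d : ℝ), a ^ 2 + b ^ 2 + c ^ 2 + d ^ 2 = 1 → ∀ v w : E,
    inner x ((X.at_ x).op a b c d v) ((X.at_ x).op a b c d w) = inner x v w

namespace QuatHermitianMetric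

variable [IsManifold 𝓘(ℝ, E) ∞ M] {X : HypercomplexStr E M} (g : QuatHermitianMetric X)

/-- The scalar product on the tangent space at `x`. -/
def at_ (x : M) : E →L[ℝ] E →L[ℝ] ℝ := g.inner x

theorem alternating_of (x : M) (A : E →L[ℝ] E) (hA : ∀ v w, g.at_ x (A v) (A w) = g.at_ x v w)
    (hsq : ∀ v, A (A v) = -v) (v : E) : g.at_ x v (A v) = 0 := by
  have h1 := hA v (A v)
  have h2 : g.at_ x (A v) v = g.at_ x v (A v) := g.symm x _ _
  rw [hsq, map_neg, h2] at h1
  linarith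

theorem alternating_I (x : M) (v : E) : g.at_ x v ((X.at_ x).I v) = 0 := by
  refine g.alternating_of x _ (fun v w => ?_) (X.at_ x).I_sq v
  have h : (X.at_ x).op 0 1 0 0 = (X.at_ x).I := by simp [QuatStr.op]
  rw [← h]
  exact g.invariant x 0 1 0 0 (by norm_num) v w

theorem alternating_J (x : M) (v : E) : g.at_ x v ((X.at_ x).J v) = 0 := by
  refine g.alternating_of x _ (fun v w => ?_) (X.at_ x).J_sq v
  have h : (X.at_ x).op 0 0 1 0 = (X.at_ x).J := by simp [QuatStr.op]
  rw [← h]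
  exact g.invariant x 0 0 1 0 (by norm_num) v w

theorem alternating_K (x : M) (v : E) : g.at_ x v ((X.at_ x).K v) = 0 := by
  refine g.alternating_of x _ (fun v w => ?_) (X.at_ x).K_sq v
  have h : (X.at_ x).op 0 0 0 1 = (X.at_ x).K := by simp [QuatStr.op]
  rw [← h]
  exact g.invariant x 0 0 0 1 (by norm_num) v w

/-- `ω_I (A, B) = g (A, B ∘ I)`. -/
def omegaI : DForm E M 2 := fun x =>
  QuatStr.fundForm (g.at_ x) (X.at_ x).I (g.alternating_I x)

/-- `ω_J (A, B) = g (A, B ∘ J)`. -/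
def omegaJ : DForm E M 2 := fun x =>
  QuatStr.fundForm (g.at_ x) (X.at_ x).J (g.alternating_J x)

/-- `ω_K (A, B) = g (A, B ∘ K)`. -/
def omegaK : DForm E M 2 := fun x =>
  QuatStr.fundForm (g.at_ x) (X.at_ x).K (g.alternating_K x)

/-- `Ω = -ω_J + √-1 ω_K`. -/
def Omega : DForm E M 2 := -g.omegaJ + Complex.I • g.omegaK

/-- `g` is an HKT-metric: `∂ Ω = 0`. -/
def IsHKT : Prop := X.del 2 0 g.Omega = 0

end QuatHermitianMetric

end Manifold

end HKT

end

noncomputable section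

namespace HKT

section LinearAlgebra

variable {E : Type*} [NormedAddCommGroup E] [NormedSpace ℝ E]

/-! ### Decomposable forms and the wedge product -/

/-! Both equations are pointwise identities, and the operator `R` carries the complex one to the
quaternionic one. On a product of `1`-forms of pure type, `R` keeps each (1,0)-factor and replaces
each (0,1)-factor b by -b ∘ J. This is the (k,0)-part of the action of the quaternion 1 - J, an
operator `rho` that is defined on all forms and is multiplicative (`rho_wedge`). It agrees with `R`
on typed forms (`IsType.R_eq`): it inverts `mix`, and on forms of type (p,q) its kernel consists of
the elements of `lowWeight`.

Two values are needed: R(ω_I) = -√-1 Ω (`rho_omegaI`) and R(∂∂̄φ) = ∂∂_Jφ (`rho_delDelbar`). For κ =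
ω_I - √-1 ∂∂̄φ they give R(κ^n) = (-√-1)^n (Ω + ∂∂_Jφ)^n. By the definition of Φ, κ^n ∧ Φ is a fixed
nonzero constant times (Ω + ∂∂_Jφ)^n ∧ conj Θ, and the same constant serves for ω_I and Ω. Wedging
with conj Θ is injective on (2n,0)-forms where Θ ≠ 0 (`eq_zero_of_wedge_conj_eq_zero`), so the two
equations are equivalent (`wpow_eq_smul_iff`). The form Φ exists because the wedge pairing is
perfect (`exists_isV_one`).

Integrability enters only through the potential φ. In a chart, ∂∂̄φ and ∂∂_Jφ are combinations of
the forms d(dφ ∘ A) for A = I, J, K (`twistedHessian`). Vanishing Nijenhuis tensors make each of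
these forms A-invariant (`dForm₂_invariant`) and relate those of anticommuting structures
(`dForm₂_anticommuting`). -/

theorem wedge_apply {k l : ℕ} (a : CForm E k) (b : CForm E l) (v : Fin (k + l) → E) :
    wedge a b v = ((k.factorial : ℂ) * (l.factorial : ℂ))⁻¹ *
      ∑ σ : Equiv.Perm (Fin (k + l)), (Equiv.Perm.sign σ : ℤ) *
        (a (fun i => v (σ (Fin.castAdd l i))) * b (fun i => v (σ (Fin.natAdd k i)))) := by
  rw [wedge, ContinuousAlternatingMap.smul_apply,
    ContinuousMultilinearMap.alternatization_apply_apply, smul_eq_mul]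
  congr 1
  refine Finset.sum_congr rfl fun σ _ => ?_
  rw [tensorProd_apply, Units.smul_def, zsmul_eq_mul]
  rfl

/-- Summing over all permutations counts each shuffle k! l! times, which is what the normalisation
of `wedge` divides out. -/
theorem wedge_eq_domCoprod {k l : ℕ} (a : CForm E k) (b : CForm E l) (v : Fin (k + l) → E) :
    wedge a b v = LinearMap.mul' ℝ ℂ
      (a.toAlternatingMap.domCoprod b.toAlternatingMap (v ∘ finSumFinEquiv)) := by
  have h := congrArg (fun F => LinearMap.mul' ℝ ℂ (F (v ∘ finSumFinEquiv)))
    (MultilinearMap.domCoprod_alternization_eq a.toAlternatingMap b.toAlternatingMap)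
  simp only [Fintype.card_fin, AlternatingMap.smul_apply, map_nsmul] at h
  rw [wedge_apply, inv_mul_eq_iff_eq_mul₀ (by simp [Nat.factorial_ne_zero]), ← Nat.cast_mul, ← nsmul_eq_mul, ← h,
    MultilinearMap.alternatization_apply, map_sum]
  refine (Fintype.sum_equiv (Equiv.permCongr finSumFinEquiv) _ _ fun σ => ?_).symm
  rw [Units.smul_def, map_zsmul, zsmul_eq_mul, Equiv.Perm.sign_permCongr]
  simp [MultilinearMap.domCoprod_apply]

/-- The wedge product as a bilinear map. -/
def wedgeL (E : Type*) [NormedAddCommGroup E] [NormedSpace ℝ E] (k l : ℕ) :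
    CForm E k →ₗ[ℂ] CForm E l →ₗ[ℂ] CForm E (k + l) :=
  LinearMap.mk₂ ℂ wedge
    (fun a a' b => by
      ext v
      simp only [wedge_apply, ContinuousAlternatingMap.add_apply, add_mul, mul_add,
        Finset.sum_add_distrib])
    (fun c a b => by
      ext v
      simp only [wedge_apply, ContinuousAlternatingMap.smul_apply, Finset.mul_sum, smul_eq_mul]
      exact Finset.sum_congr rfl fun σ _ => by ring)
    (fun a b b' => by
      ext v
      simp only [wedge_apply, ContinuousAlternatingMap.add_apply, mul_add,
        Finset.sum_add_distrib])
    (fun c a b => by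
      ext v
      simp only [wedge_apply, ContinuousAlternatingMap.smul_apply, Finset.mul_sum, smul_eq_mul]
      exact Finset.sum_congr rfl fun σ _ => by ring)

@[simp]
theorem wedgeL_apply {k l : ℕ} (a : CForm E k) (b : CForm E l) :
    wedgeL E k l a b = wedge a b := rfl

/-- The function underlying `dec`. -/
def decFun {k : ℕ} (a : Fin k → E →L[ℝ] ℂ) : CForm E k :=
  ContinuousMultilinearMap.alternatization
    ((ContinuousMultilinearMap.mkPiAlgebra ℝ (Fin k) ℂ).compContinuousLinearMap a)

/-- Evaluation of `1`-forms at a family of vectors. -/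
def evalVec {k : ℕ} (v : Fin k → E) : (E →L[ℝ] ℂ) →ₗ[ℂ] (Fin k → ℂ) where
  toFun c i := c (v i)
  map_add' _ _ := rfl
  map_smul' _ _ := rfl

theorem decFun_apply {k : ℕ} (a : Fin k → E →L[ℝ] ℂ) (v : Fin k → E) :
    decFun a v = Matrix.detRowAlternating.compLinearMap (evalVec v) a := by
  rw [decFun, ContinuousMultilinearMap.alternatization_apply_apply]
  change _ = (Matrix.of fun j i => a j (v i)).det
  rw [← Matrix.det_transpose, Matrix.det_apply]
  rfl

/-- The product `a₁ ∧ ⋯ ∧ a_k` of `1`-forms, as an alternating function of the factors. -/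
def dec {k : ℕ} : (E →L[ℝ] ℂ) [⋀^Fin k]→ₗ[ℂ] CForm E k where
  toFun := decFun
  map_update_add' m i x y := by
    ext v
    simp only [ContinuousAlternatingMap.add_apply, decFun_apply]
    convert! AlternatingMap.map_update_add _ m i x y
  map_update_smul' m i c x := by
    ext v
    simp only [ContinuousAlternatingMap.smul_apply, decFun_apply]
    convert! AlternatingMap.map_update_smul _ m i c x
  map_eq_zero_of_eq' m i j h hij := by
    ext v
    rw [decFun_apply]
    exact AlternatingMap.map_eq_zero_of_eq _ m h hij

theorem dec_apply {k : ℕ} (a : Fin k → E →L[ℝ] ℂ) (v : Fin k → E) :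
    dec a v = (Matrix.of fun i j => a j (v i)).det := by
  change decFun a v = _
  rw [decFun, ContinuousMultilinearMap.alternatization_apply_apply, Matrix.det_apply]
  rfl

theorem pull_dec {k : ℕ} (A : E →L[ℝ] E) (a : Fin k → E →L[ℝ] ℂ) :
    pull A (dec a) = dec fun i => (a i).comp A := by
  ext v
  change dec a (fun i => A (v i)) = _
  rw [dec_apply, dec_apply]
  rfl

theorem const0_one_eq_dec : const0 E 1 = dec (Fin.elim0 : Fin 0 → E →L[ℝ] ℂ) := by
  ext v
  rw [dec_apply, Matrix.det_fin_zero]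
  rfl

theorem castDeg_dec {k l : ℕ} (h : k = l) (a : Fin k → E →L[ℝ] ℂ) :
    castDeg h (dec a) = dec (a ∘ Fin.cast h.symm) := by
  subst h
  rfl

/-- Alternatizing a product of two alternatizations is the same as alternatizing the product once
over shuffles, so no factorials survive. -/
theorem wedge_dec {k l : ℕ} (a : Fin k → E →L[ℝ] ℂ) (b : Fin l → E →L[ℝ] ℂ) :
    wedge (dec a) (dec b) = dec (Fin.append a b) := by
  ext v
  have key : (dec a).toAlternatingMap.domCoprod (dec b).toAlternatingMap =
      MultilinearMap.alternatization (MultilinearMap.domCoprod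
        (((ContinuousMultilinearMap.mkPiAlgebra ℝ (Fin k) ℂ).compContinuousLinearMap
          a).toMultilinearMap)
        (((ContinuousMultilinearMap.mkPiAlgebra ℝ (Fin l) ℂ).compContinuousLinearMap
          b).toMultilinearMap)) := by
    rw [MultilinearMap.domCoprod_alternization]
    congr 1 <;> exact ContinuousMultilinearMap.alternatization_apply_toAlternatingMap _
  rw [wedge_eq_domCoprod, key, MultilinearMap.alternatization_apply, map_sum, dec_apply,
    Matrix.det_apply]
  refine Fintype.sum_equiv (Equiv.permCongr finSumFinEquiv) _ _ fun σ => ?_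
  rw [Units.smul_def, map_zsmul, Equiv.Perm.sign_permCongr, Units.smul_def, Fin.prod_univ_add]
  simp [MultilinearMap.domCoprod_apply]

/-- The complex `1`-forms dual to a real basis. -/
def dualForm [FiniteDimensional ℝ E] {ι : Type*} (b : Module.Basis ι ℝ E) (i : ι) : E →L[ℝ] ℂ :=
  Complex.ofRealCLM.comp (LinearMap.toContinuousLinearMap (b.coord i))

theorem dualForm_apply [FiniteDimensional ℝ E] {ι : Type*} (b : Module.Basis ι ℝ E) (i : ι)
    (v : E) : dualForm b i v = (b.repr v i : ℂ) := rfl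

/-- The index functions s are neither increasing nor injective, so every basis product is counted
once for each ordering. This is the source of k!. -/
theorem factorial_smul_eq_sum_dec [FiniteDimensional ℝ E] {k : ℕ} {ι : Type*} [Fintype ι]
    (b : Module.Basis ι ℝ E) (ξ : CForm E k) :
    (k.factorial : ℂ) • ξ = ∑ s : Fin k → ι, ξ (b ∘ s) • dec fun i => dualForm b (s i) := by
  have expand : ∀ v : Fin k → E,
      ξ v = ∑ s : Fin k → ι, ξ (b ∘ s) * ∏ i, dualForm b (s i) (v i) := fun v => by
    classical
    conv_lhs => rw [show v = fun i => ∑ j, b.repr (v i) j • b j from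
      funext fun i => (b.sum_repr (v i)).symm]
    rw [ContinuousAlternatingMap.map_sum]
    refine Finset.sum_congr rfl fun s _ => ?_
    rw [ContinuousAlternatingMap.map_smul_univ, Complex.real_smul, mul_comm, Complex.ofReal_prod]
    rfl
  ext v
  have h1 : ∀ σ : Equiv.Perm (Fin k), ξ v = (Equiv.Perm.sign σ : ℤ) * ξ (v ∘ σ) := fun σ => by
    have h := ξ.toAlternatingMap.map_perm v σ
    rw [Units.smul_def, zsmul_eq_mul] at h
    change ξ (v ∘ σ) = _ * ξ v at h
    rw [h, ← mul_assoc, ← Int.cast_mul, ← Units.val_mul, Int.units_mul_self]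
    simp
  have h2 : (k.factorial : ℂ) * ξ v =
      ∑ σ : Equiv.Perm (Fin k), (Equiv.Perm.sign σ : ℤ) * ξ (v ∘ σ) := by
    rw [← Finset.sum_congr rfl fun σ _ => h1 σ, Finset.sum_const, Finset.card_univ,
      Fintype.card_perm, Fintype.card_fin, nsmul_eq_mul]
  rw [ContinuousAlternatingMap.smul_apply, smul_eq_mul, h2,
    Finset.sum_congr rfl fun σ _ => by rw [expand (v ∘ σ), Finset.mul_sum], Finset.sum_comm,
    ContinuousAlternatingMap.sum_apply]
  refine Finset.sum_congr rfl fun s _ => ?_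
  rw [ContinuousAlternatingMap.smul_apply, dec_apply, Matrix.det_apply, smul_eq_mul,
    Finset.mul_sum]
  refine Finset.sum_congr rfl fun σ _ => ?_
  rw [Units.smul_def, zsmul_eq_mul]
  simp only [Function.comp_apply, Matrix.of_apply]
  ring

/-- Products of `k` elements of a set of `1`-forms. -/
def decSet (k : ℕ) (S : Set (E →L[ℝ] ℂ)) : Set (CForm E k) :=
  {ξ | ∃ a : Fin k → E →L[ℝ] ℂ, (∀ i, a i ∈ S) ∧ ξ = dec a}

/-- Multilinearity, one slot at a time: the induction is on a set of slots outside of which the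
factors already lie in S. -/
theorem dec_mem_span_decSet {k : ℕ} {S : Set (E →L[ℝ] ℂ)} (a : Fin k → E →L[ℝ] ℂ)
    (ha : ∀ i, a i ∈ Submodule.span ℂ S) : dec a ∈ Submodule.span ℂ (decSet k S) := by
  suffices h : ∀ (t : Finset (Fin k)) (a : Fin k → E →L[ℝ] ℂ),
      (∀ i, a i ∈ Submodule.span ℂ S) → (∀ i ∉ t, a i ∈ S) →
      dec a ∈ Submodule.span ℂ (decSet k S) from
    h Finset.univ a ha fun i hi => absurd (Finset.mem_univ i) hi
  intro t
  induction t using Finset.induction_on with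
  | empty => exact fun a _ h => Submodule.subset_span ⟨a, fun i => h i (by simp), rfl⟩
  | insert j t _ ih =>
    intro a ha h
    rw [← Function.update_eq_self j a]
    refine Submodule.span_induction (p := fun x _ => dec (Function.update a j x) ∈ _)
      (fun x hx => ?_) ?_ (fun x y _ _ hx hy => ?_) (fun c x _ hx => ?_) (ha j)
    · refine ih _ (fun i => ?_) fun i hi => ?_
      · rcases eq_or_ne i j with rfl | hij
        · simpa using Submodule.subset_span hx
        · simpa [hij] using ha i
      · rcases eq_or_ne i j with rfl | hij
        · simpa using hx
        · simpa [hij] using h i (by simp [hij, hi])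
    · rw [AlternatingMap.map_update_zero]
      exact Submodule.zero_mem _
    · rw [AlternatingMap.map_update_add]
      exact Submodule.add_mem _ hx hy
    · rw [AlternatingMap.map_update_smul]
      exact Submodule.smul_mem _ c hx

/-- Forms are spanned by products of elements of a set spanning the `1`-forms. -/
theorem span_decSet_eq_top [FiniteDimensional ℝ E] (k : ℕ) {S : Set (E →L[ℝ] ℂ)}
    (hS : Submodule.span ℂ S = ⊤) : Submodule.span ℂ (decSet (E := E) k S) = ⊤ := by
  refine eq_top_iff.2 fun ξ _ => ?_
  have hk : (k.factorial : ℂ) ≠ 0 := by simp [Nat.factorial_ne_zero]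
  rw [← inv_smul_smul₀ hk ξ, factorial_smul_eq_sum_dec (Module.finBasis ℝ E)]
  exact Submodule.smul_mem _ _ <| Submodule.sum_mem _ fun s _ => Submodule.smul_mem _ _ <|
    dec_mem_span_decSet _ fun i => by rw [hS]; trivial

instance [FiniteDimensional ℝ E] (k : ℕ) : Module.Finite ℂ (CForm E k) := by
  classical
  refine ⟨⟨(Finset.univ : Finset (Fin k → Fin (Module.finrank ℝ E))).image
    fun s => dec fun i => dualForm (Module.finBasis ℝ E) (s i), eq_top_iff.2 fun ξ _ => ?_⟩⟩
  have hk : (k.factorial : ℂ) ≠ 0 := by simp [Nat.factorial_ne_zero]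
  rw [← inv_smul_smul₀ hk ξ, factorial_smul_eq_sum_dec (Module.finBasis ℝ E)]
  exact Submodule.smul_mem _ _ <| Submodule.sum_mem _ fun s _ => Submodule.smul_mem _ _ <|
    Submodule.subset_span (by simp)

/-- Reduces bilinear identities between forms to products of `1`-forms, where they become statements
about lists of factors. -/
theorem wedge_eq_of_dec [FiniteDimensional ℝ E] {k l m : ℕ}
    (F G : CForm E k →ₗ[ℂ] CForm E l →ₗ[ℂ] CForm E m)
    (h : ∀ a b, F (dec a) (dec b) = G (dec a) (dec b)) : F = G := by
  refine LinearMap.ext_on (span_decSet_eq_top k Submodule.span_univ) ?_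
  rintro _ ⟨a, -, rfl⟩
  refine LinearMap.ext_on (span_decSet_eq_top l Submodule.span_univ) ?_
  rintro _ ⟨b, -, rfl⟩
  exact h a b

end LinearAlgebra

section Weights

variable {E : Type*} [NormedAddCommGroup E] [NormedSpace ℝ E]

/-! ### Weights -/

/-- The action of an endomorphism on forms, as a linear map. -/
def pullL (k : ℕ) (A : E →L[ℝ] E) : CForm E k →ₗ[ℂ] CForm E k where
  toFun := pull A
  map_add' _ _ := rfl
  map_smul' _ _ := rfl

@[simp]
theorem pullL_apply {k : ℕ} (A : E →L[ℝ] E) (ξ : CForm E k) : pullL k A ξ = pull A ξ := rfl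

theorem pull_pull {k : ℕ} (A B : E →L[ℝ] E) (ξ : CForm E k) :
    pull A (pull B ξ) = pull (B.comp A) ξ := rfl

namespace QuatStr

variable (H : QuatStr E)

theorem op_apply (a b c d : ℝ) (v : E) :
    H.op a b c d v = a • v + b • H.I v + c • H.J v + d • H.K v := rfl

theorem rot_apply (θ : ℝ) (v : E) : H.rot θ v = Real.cos θ • v + Real.sin θ • H.I v := by
  simp [rot, op_apply]

/-- `c (v ∘ I) = √-1 e c v`; for `e = 1` the form is of type `(1,0)`, for `e = -1` of type
`(0,1)`. -/
def IsPure (e : ℤ) (c : E →L[ℝ] ℂ) : Prop := ∀ v, c (H.I v) = Complex.I * e * c v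

theorem IsPure.comp_rot {H : QuatStr E} {e : ℤ} (he : e = 1 ∨ e = -1) {c : E →L[ℝ] ℂ}
    (h : H.IsPure e c) (θ : ℝ) :
    c.comp (H.rot θ) = Complex.exp (Complex.I * (e : ℂ) * (θ : ℂ)) • c := by
  ext v
  have h1 : Complex.I * (e : ℂ) * (θ : ℂ) = ((e * θ : ℝ) : ℂ) * Complex.I := by
    push_cast; ring
  rw [ContinuousLinearMap.comp_apply, rot_apply, map_add, map_smul, map_smul, h v,
    _root_.smul_apply, h1, Complex.exp_mul_I, ← Complex.ofReal_cos,
    ← Complex.ofReal_sin]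
  rcases he with rfl | rfl
  · simp [smul_eq_mul]; ring
  · simp [smul_eq_mul]; ring

theorem hasWeight_dec {k : ℕ} {e : Fin k → ℤ} (he : ∀ i, e i = 1 ∨ e i = -1)
    {a : Fin k → E →L[ℝ] ℂ} (ha : ∀ i, H.IsPure (e i) (a i)) :
    H.HasWeight (∑ i, e i) (dec a) := fun θ => by
  rw [pull_dec, show (fun i => (a i).comp (H.rot θ)) =
      fun i => Complex.exp (Complex.I * (e i : ℂ) * (θ : ℂ)) • a i from
    funext fun i => (ha i).comp_rot (he i) θ]
  have h := dec.map_smul_univ (fun i => Complex.exp (Complex.I * (e i : ℂ) * (θ : ℂ))) a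
  refine h.trans ?_
  rw [← Complex.exp_sum, Int.cast_sum, Finset.mul_sum, Finset.sum_mul]

/-- The `(1,0)`-part of a `1`-form. -/
def c10 : (E →L[ℝ] ℂ) →ₗ[ℂ] (E →L[ℝ] ℂ) where
  toFun c := (2⁻¹ : ℂ) • (c - Complex.I • c.comp H.I)
  map_add' c c' := by ext v; simp; ring
  map_smul' r c := by ext v; simp; ring

/-- The `(0,1)`-part of a `1`-form. -/
def c01 : (E →L[ℝ] ℂ) →ₗ[ℂ] (E →L[ℝ] ℂ) where
  toFun c := (2⁻¹ : ℂ) • (c + Complex.I • c.comp H.I)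
  map_add' c c' := by ext v; simp; ring
  map_smul' r c := by ext v; simp; ring

theorem c10_apply (c : E →L[ℝ] ℂ) (v : E) :
    H.c10 c v = 2⁻¹ * (c v - Complex.I * c (H.I v)) := rfl

theorem c01_apply (c : E →L[ℝ] ℂ) (v : E) :
    H.c01 c v = 2⁻¹ * (c v + Complex.I * c (H.I v)) := rfl

theorem c10_add_c01 (c : E →L[ℝ] ℂ) : H.c10 c + H.c01 c = c := by
  ext v
  rw [_root_.add_apply, c10_apply, c01_apply]
  ring

theorem isPure_c10 (c : E →L[ℝ] ℂ) : H.IsPure 1 (H.c10 c) := fun v => by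
  rw [c10_apply, c10_apply, H.I_sq, map_neg]
  push_cast
  linear_combination (2⁻¹ * c (H.I v)) * Complex.I_mul_I

theorem isPure_c01 (c : E →L[ℝ] ℂ) : H.IsPure (-1) (H.c01 c) := fun v => by
  rw [c01_apply, c01_apply, H.I_sq, map_neg]
  push_cast
  linear_combination (2⁻¹ * c (H.I v)) * Complex.I_mul_I

theorem IsPure.c10_eq {H : QuatStr E} {c : E →L[ℝ] ℂ} (h : H.IsPure 1 c) : H.c10 c = c := by
  ext v
  rw [c10_apply, h v]
  push_cast
  linear_combination (-2⁻¹ * c v) * Complex.I_mul_I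

theorem IsPure.c10_eq_zero {H : QuatStr E} {c : E →L[ℝ] ℂ} (h : H.IsPure (-1) c) :
    H.c10 c = 0 := by
  ext v
  rw [c10_apply, h v, _root_.zero_apply]
  push_cast
  linear_combination (2⁻¹ * c v) * Complex.I_mul_I

theorem IsPure.comp_J {H : QuatStr E} {e : ℤ} {c : E →L[ℝ] ℂ} (h : H.IsPure e c) :
    H.IsPure (-e) (c.comp H.J) := fun v => by
  have h1 : H.J (H.I v) = -H.I (H.J v) := by rw [H.anti, neg_neg]
  rw [ContinuousLinearMap.comp_apply, h1, map_neg, h, ContinuousLinearMap.comp_apply]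
  push_cast
  ring

/-- The `1`-forms of type `(1,0)` or `(0,1)`. -/
def pureSet : Set (E →L[ℝ] ℂ) := {c | ∃ e : ℤ, (e = 1 ∨ e = -1) ∧ H.IsPure e c}

theorem span_pureSet : Submodule.span ℂ H.pureSet = ⊤ := by
  refine eq_top_iff.2 fun c _ => ?_
  rw [← H.c10_add_c01 c]
  exact Submodule.add_mem _ (Submodule.subset_span ⟨1, Or.inl rfl, H.isPure_c10 c⟩)
    (Submodule.subset_span ⟨-1, Or.inr rfl, H.isPure_c01 c⟩)

variable {k : ℕ}

theorem HasWeight.add {H : QuatStr E} {m : ℤ} {ξ η : CForm E k} (h : H.HasWeight m ξ)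
    (h' : H.HasWeight m η) : H.HasWeight m (ξ + η) := fun θ => by
  rw [← pullL_apply, map_add, pullL_apply, pullL_apply, h θ, h' θ, smul_add]

theorem HasWeight.smul {H : QuatStr E} {m : ℤ} {ξ : CForm E k} (h : H.HasWeight m ξ) (c : ℂ) :
    H.HasWeight m (c • ξ) := fun θ => by
  rw [← pullL_apply, map_smul, pullL_apply, h θ, smul_comm]

theorem hasWeight_zero (m : ℤ) : H.HasWeight m (0 : CForm E k) := fun θ => by
  exact (map_zero (pullL k _)).trans (smul_zero _).symm

/-- The forms of weight `m`. -/
def weightSpace (k : ℕ) (m : ℤ) : Submodule ℂ (CForm E k) where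
  carrier := {ξ | H.HasWeight m ξ}
  add_mem' h h' := h.add h'
  zero_mem' := H.hasWeight_zero m
  smul_mem' c _ h := h.smul c

theorem mem_weightSpace {m : ℤ} {ξ : CForm E k} : ξ ∈ H.weightSpace k m ↔ H.HasWeight m ξ :=
  Iff.rfl

/-- Orthogonality of the characters of the circle. -/
theorem HasWeight.weightProj_eq {H : QuatStr E} {m m' : ℤ} {ξ : CForm E k}
    (h : H.HasWeight m' ξ) : H.weightProj m ξ = if m' = m then ξ else 0 := by
  have h1 : ∀ θ : ℝ, Complex.exp (-(Complex.I * (m : ℂ) * (θ : ℂ))) • pull (H.rot θ) ξ =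
      Complex.exp ((Complex.I * ((m' - m : ℤ) : ℂ)) * (θ : ℂ)) • ξ := fun θ => by
    rw [h θ, smul_smul, ← Complex.exp_add]
    congr 2
    push_cast
    ring
  rw [weightProj]
  simp_rw [h1]
  rw [intervalIntegral.integral_smul_const]
  split_ifs with hm
  · subst hm
    have : (2 * Real.pi) ≠ 0 := by positivity
    simp only [sub_self, Int.cast_zero, mul_zero, zero_mul, Complex.exp_zero,
      intervalIntegral.integral_const, sub_zero, smul_assoc, one_smul]
    rw [smul_smul, inv_mul_cancel₀ this, one_smul]
  · have hc : Complex.I * ((m' - m : ℤ) : ℂ) ≠ 0 :=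
      mul_ne_zero Complex.I_ne_zero (Int.cast_ne_zero.2 (sub_ne_zero.2 hm))
    have he : Complex.exp (Complex.I * ((m' - m : ℤ) : ℂ) * ((2 * Real.pi : ℝ) : ℂ)) = 1 := by
      rw [← Complex.exp_int_mul_two_pi_mul_I (m' - m)]
      congr 1
      push_cast
      ring
    rw [integral_exp_mul_complex hc, he]
    simp

variable [FiniteDimensional ℝ E]

/-- Induction over products of `1`-forms of pure type. -/
theorem pure_induction {p : CForm E k → Prop} (hadd : ∀ ξ η, p ξ → p η → p (ξ + η))
    (hsmul : ∀ (c : ℂ) ξ, p ξ → p (c • ξ))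
    (hdec : ∀ (e : Fin k → ℤ) (a : Fin k → E →L[ℝ] ℂ), (∀ i, e i = 1 ∨ e i = -1) →
      (∀ i, H.IsPure (e i) (a i)) → p (dec a)) (ξ : CForm E k) : p ξ := by
  have hd : ∀ x ∈ decSet k H.pureSet, p x := by
    rintro _ ⟨a, ha, rfl⟩
    choose e he ha using ha
    exact hdec e a he ha
  have h0 : p 0 := by
    have := hsmul 0 _ (hd (dec fun _ => (0 : E →L[ℝ] ℂ))
      ⟨_, fun _ => ⟨1, Or.inl rfl, fun v => by simp⟩, rfl⟩)
    exact (zero_smul ℂ (dec fun _ : Fin k => (0 : E →L[ℝ] ℂ))) ▸ this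
  have hξ : ξ ∈ Submodule.span ℂ (decSet k H.pureSet) := by
    rw [span_decSet_eq_top k H.span_pureSet]; trivial
  exact Submodule.span_induction hd h0 (fun x y _ _ => hadd x y) (fun c x _ => hsmul c x) hξ

/-- Makes the integrand of `weightProj` integrable, hence `weightProj` additive. -/
theorem continuous_pull_rot (ξ : CForm E k) : Continuous fun θ : ℝ => pull (H.rot θ) ξ := by
  refine H.pure_induction (p := fun ξ => Continuous fun θ : ℝ => pull (H.rot θ) ξ)
    (fun ξ η h h' => h.add h') (fun c ξ h => h.const_smul c) (fun e a he ha => ?_) ξ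
  have h : (fun θ : ℝ => pull (H.rot θ) (dec a)) =
      fun θ : ℝ => Complex.exp (Complex.I * ((∑ i, e i : ℤ) : ℂ) * (θ : ℂ)) • dec a :=
    funext (H.hasWeight_dec he ha)
  rw [h]
  have hc : Continuous fun θ : ℝ => Complex.exp (Complex.I * ((∑ i, e i : ℤ) : ℂ) * (θ : ℂ)) := by
    fun_prop
  exact hc.smul continuous_const

theorem continuous_weight_integrand (m : ℤ) (ξ : CForm E k) :
    Continuous fun θ : ℝ => Complex.exp (-(Complex.I * (m : ℂ) * (θ : ℂ))) •
      pull (H.rot θ) ξ := by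
  have hc : Continuous fun θ : ℝ => Complex.exp (-(Complex.I * (m : ℂ) * (θ : ℂ))) := by
    fun_prop
  exact hc.smul (H.continuous_pull_rot ξ)

/-- The projection to the component of weight `m`, as a linear map. -/
def weightProjL (k : ℕ) (m : ℤ) : CForm E k →ₗ[ℂ] CForm E k where
  toFun := H.weightProj m
  map_add' ξ η := by
    have h : ∀ ξ : CForm E k, IntervalIntegrable (fun θ : ℝ =>
        Complex.exp (-(Complex.I * (m : ℂ) * (θ : ℂ))) • pull (H.rot θ) ξ)
        MeasureTheory.volume 0 (2 * Real.pi) :=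
      fun ξ => (H.continuous_weight_integrand m ξ).intervalIntegrable _ _
    refine Eq.trans ?_ (smul_add _ _ _)
    rw [← intervalIntegral.integral_add (h ξ) (h η), weightProj]
    congr 2
    funext θ
    exact smul_add _ (pull (H.rot θ) ξ) (pull (H.rot θ) η)
  map_smul' c ξ := by
    refine Eq.trans ?_ (smul_comm (2 * Real.pi)⁻¹ c (∫ θ in (0 : ℝ)..(2 * Real.pi),
      Complex.exp (-(Complex.I * (m : ℂ) * (θ : ℂ))) • pull (H.rot θ) ξ))
    rw [weightProj]
    congr 1
    refine Eq.trans ?_ (intervalIntegral.integral_smul _ _)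
    congr 1
    funext θ
    exact smul_comm (Complex.exp (-(Complex.I * (m : ℂ) * (θ : ℂ)))) c (pull (H.rot θ) ξ)

@[simp]
theorem weightProjL_apply (m : ℤ) (ξ : CForm E k) :
    H.weightProjL k m ξ = H.weightProj m ξ := rfl

theorem hasWeight_weightProj (m : ℤ) (ξ : CForm E k) : H.HasWeight m (H.weightProj m ξ) := by
  refine H.pure_induction (p := fun ξ => H.HasWeight m (H.weightProj m ξ))
    (fun ξ η h h' => ?_) (fun c ξ h => ?_) (fun e a he ha => ?_) ξ
  · rw [← weightProjL_apply, map_add]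
    exact h.add h'
  · rw [← weightProjL_apply, map_smul]
    exact h.smul c
  · rw [(H.hasWeight_dec he ha).weightProj_eq]
    split_ifs with hm
    · exact hm ▸ H.hasWeight_dec he ha
    · exact H.hasWeight_zero m

theorem sum_sign_le {e : Fin k → ℤ} (he : ∀ i, e i = 1 ∨ e i = -1) : ∑ i, e i ≤ k := by
  calc ∑ i, e i ≤ ∑ _i : Fin k, 1 := Finset.sum_le_sum fun i _ => by rcases he i with h | h <;> omega
    _ = k := by simp

/-- A product of k pure `1`-forms has as weight a sum of k signs, so the projection to any weight
above k is zero. -/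
theorem HasWeight.le {H : QuatStr E} {m : ℤ} {ξ : CForm E k} (h : H.HasWeight m ξ) (h0 : ξ ≠ 0) :
    m ≤ k := by
  by_contra hm
  refine h0 ?_
  rw [← (h.weightProj_eq (m := m)).trans (if_pos rfl)]
  refine H.pure_induction (p := fun ξ => H.weightProj m ξ = 0)
    (fun ξ η h h' => ?_) (fun c ξ h => ?_) (fun e a he ha => ?_) ξ
  · rw [← weightProjL_apply, map_add, weightProjL_apply, weightProjL_apply, h, h', add_zero]
  · rw [← weightProjL_apply, map_smul, weightProjL_apply, h]
    exact smul_zero (A := CForm E k) c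
  · rw [(H.hasWeight_dec he ha).weightProj_eq, if_neg]
    have := sum_sign_le he
    omega

/-- Splitting each factor into its two types, only the product of all the (1,0)-parts reaches the
top weight k. -/
theorem weightProj_top_dec (c : Fin k → E →L[ℝ] ℂ) :
    H.weightProj k (dec c) = dec fun i => H.c10 (c i) := by
  conv_lhs => rw [← funext fun i => H.c10_add_c01 (c i)]
  have hsum := dec.map_add_univ (fun i => H.c10 (c i)) (fun i => H.c01 (c i))
  rw [show (dec fun i => H.c10 (c i) + H.c01 (c i)) = _ from hsum, ← weightProjL_apply, map_sum,
    Finset.sum_eq_single Finset.univ]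
  · rw [Finset.piecewise_univ, weightProjL_apply,
      (H.hasWeight_dec (e := fun _ => 1) (fun _ => Or.inl rfl)
        fun i => H.isPure_c10 (c i)).weightProj_eq, if_pos (by simp)]
  · intro s _ hs
    have he : ∀ i, (if i ∈ s then (1 : ℤ) else -1) = 1 ∨ (if i ∈ s then (1 : ℤ) else -1) = -1 :=
      fun i => by split_ifs <;> simp
    rw [weightProjL_apply, (H.hasWeight_dec he fun i => ?_).weightProj_eq, if_neg]
    · obtain ⟨i, hi⟩ : ∃ i, i ∉ s := by
        by_contra! h
        exact hs (Finset.eq_univ_iff_forall.2 h)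
      refine ne_of_lt ?_
      calc ∑ j, (if j ∈ s then (1 : ℤ) else -1) < ∑ _j : Fin k, (1 : ℤ) :=
            Finset.sum_lt_sum (fun j _ => by split_ifs <;> simp) ⟨i, Finset.mem_univ i, by simp [hi]⟩
        _ = k := by simp
    · by_cases hi : i ∈ s
      · simpa [hi] using H.isPure_c10 (c i)
      · simpa [hi] using H.isPure_c01 (c i)
  · simp

end QuatStr

end Weights

section OperatorR

variable {E : Type*} [NormedAddCommGroup E] [NormedSpace ℝ E]

/-! ### The operator `R` -/

theorem pull_wedge {k l : ℕ} (A : E →L[ℝ] E) (a : CForm E k) (b : CForm E l) :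
    pull A (wedge a b) = wedge (pull A a) (pull A b) := by
  ext v
  change wedge a b (fun i => A (v i)) = _
  rw [wedge_apply, wedge_apply]
  rfl

namespace QuatStr

variable (H : QuatStr E) {k : ℕ}

theorem HasWeight.wedge {H : QuatStr E} {k l : ℕ} {m m' : ℤ} {a : CForm E k} {b : CForm E l}
    (ha : H.HasWeight m a) (hb : H.HasWeight m' b) : H.HasWeight (m + m') (wedge a b) := fun θ => by
  rw [pull_wedge, ha θ, hb θ, ← wedgeL_apply, map_smul, map_smul, LinearMap.smul_apply, smul_smul,
    ← Complex.exp_add, wedgeL_apply]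
  congr 2
  push_cast
  ring

theorem HasWeight.conj {H : QuatStr E} {m : ℤ} {a : CForm E k} (ha : H.HasWeight m a) :
    H.HasWeight (-m) (conj a) := fun θ => by
  ext v
  have h := congrArg (fun ξ : CForm E k => (starRingEnd ℂ) (ξ v)) (ha θ)
  change (starRingEnd ℂ) (pull (H.rot θ) a v) = (starRingEnd ℂ) (_ * a v) at h
  change (starRingEnd ℂ) (pull (H.rot θ) a v) = _ * (starRingEnd ℂ) (a v)
  rw [h, map_mul, ← Complex.exp_conj]
  congr 2
  simp

/-- The action is on the right, so applying q' and then q is the action of q'q; the coefficients are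
those of q'q. -/
theorem op_op (a b c d a' b' c' d' : ℝ) (v : E) :
    H.op a b c d (H.op a' b' c' d' v) =
      H.op (a * a' - b * b' - c * c' - d * d') (a * b' + b * a' - c * d' + d * c')
        (a * c' + c * a' + b * d' - d * b') (a * d' + d * a' - b * c' + c * b') v := by
  simp only [op_apply, H.K_eq, map_add, map_smul, H.anti, H.I_sq, H.J_sq, map_neg, smul_neg,
    neg_neg]
  module

theorem op_comp_op (a b c d a' b' c' d' : ℝ) :
    (H.op a b c d).comp (H.op a' b' c' d') =
      H.op (a * a' - b * b' - c * c' - d * d') (a * b' + b * a' - c * d' + d * c')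
        (a * c' + c * a' + b * d' - d * b') (a * d' + d * a' - b * c' + c * b') :=
  ContinuousLinearMap.ext fun v => H.op_op a b c d a' b' c' d' v

/-- Composition with J and K changes the type of f, so only the part a + bI contributes; I acts on f
as √-1. -/
theorem IsPure.c10_comp_op_of_one {H : QuatStr E} {f : E →L[ℝ] ℂ} (h : H.IsPure 1 f)
    (a b c d : ℝ) : H.c10 (f.comp (H.op a b c d)) = ((a : ℂ) + b * Complex.I) • f := by
  ext v
  have h1 : ∀ w, f (H.I w) = Complex.I * f w := fun w => by simpa using h w
  simp only [c10_apply, ContinuousLinearMap.comp_apply, op_apply, H.K_eq, map_add, map_smul,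
    H.I_sq, map_neg, h1, _root_.smul_apply, smul_eq_mul, Complex.real_smul]
  have h2 : f (H.J (H.I v)) = -(Complex.I * f (H.J v)) := by rw [← h1, H.anti, map_neg, neg_neg]
  rw [h2]
  linear_combination ((-(a : ℂ) / 2 * f v + (c : ℂ) / 2 * f (H.J v))) * Complex.I_mul_I

/-- Here f itself is of type (0,1), so only the part cJ + dK contributes. -/
theorem IsPure.c10_comp_op_of_neg_one {H : QuatStr E} {f : E →L[ℝ] ℂ} (h : H.IsPure (-1) f)
    (a b c d : ℝ) :
    H.c10 (f.comp (H.op a b c d)) = ((c : ℂ) + d * Complex.I) • f.comp H.J := by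
  ext v
  have h1 : ∀ w, f (H.I w) = -(Complex.I * f w) := fun w => by simpa using h w
  simp only [c10_apply, ContinuousLinearMap.comp_apply, op_apply, H.K_eq, map_add, map_smul,
    H.I_sq, map_neg, h1, _root_.smul_apply, smul_eq_mul, Complex.real_smul]
  have h2 : f (H.J (H.I v)) = Complex.I * f (H.J v) := by
    have := h1 (H.J v)
    rw [H.anti, map_neg, neg_inj] at this
    exact this
  rw [h2]
  linear_combination (((a : ℂ) / 2 * f v - (c : ℂ) / 2 * f (H.J v))) * Complex.I_mul_I

/-- The map `η ↦ h₁^p h₂^{k-p} ⊗ η`, as a linear map. -/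
def mixL (k p : ℕ) : CForm E k →ₗ[ℂ] CForm E k where
  toFun := H.mix p
  map_add' ξ η := by
    rw [mix, mix, mix]
    refine Eq.trans ?_ (smul_add (A := CForm E k) _ _ _)
    rw [← map_add]
    rfl
  map_smul' c ξ := by
    rw [mix, mix, RingHom.id_apply]
    refine Eq.trans ?_ (smul_comm (α := CForm E k) _ _ _)
    congr 1
    ext v
    simp only [ContinuousAlternatingMap.smul_apply,
      ContinuousMultilinearMap.alternatization_apply_apply, Finset.smul_sum]
    refine Finset.sum_congr rfl fun σ _ => ?_
    rw [smul_comm]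
    rfl

/-- The endomorphism acting on the factor number `i` in `mix p`. -/
def mixFactor (p i : ℕ) : E →L[ℝ] E := if i < p then ContinuousLinearMap.id ℝ E else H.J

/-- Expanding the determinant over permutations of the factors and interchanging this sum with the
alternatization over vectors regroups the terms into products of `1`-forms. -/
theorem mix_dec (p : ℕ) (a : Fin k → E →L[ℝ] ℂ) :
    H.mix p (dec a) = ((k.factorial : ℂ))⁻¹ • ∑ τ : Equiv.Perm (Fin k),
      ((Equiv.Perm.sign τ : ℤ) : ℂ) • dec fun i => (a (τ i)).comp (H.mixFactor p i) := by
  rw [mix]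
  congr 1
  ext v
  rw [ContinuousMultilinearMap.alternatization_apply_apply, ContinuousAlternatingMap.sum_apply]
  simp only [ContinuousAlternatingMap.smul_apply, dec_apply, Matrix.det_apply, Finset.smul_sum]
  rw [Finset.sum_comm]
  refine Finset.sum_congr rfl fun σ _ => ?_
  change Equiv.Perm.sign σ • dec a (fun i => H.mixFactor p i (v (σ i))) = _
  rw [dec_apply, ← Matrix.det_transpose, Matrix.det_apply, Finset.smul_sum]
  refine Finset.sum_congr rfl fun τ _ => ?_
  rw [smul_comm, Units.smul_def, zsmul_eq_mul, smul_eq_mul]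
  rfl

/-- The quaternion 1 - J undoes the mixing: its 1 handles the unchanged factors, and on a factor
composed with J its -J gives -J² = 1. -/
theorem IsPure.c10_comp_mixFactor {H : QuatStr E} {f : E →L[ℝ] ℂ} (h : H.IsPure 1 f) (p i : ℕ) :
    H.c10 ((f.comp (H.mixFactor p i)).comp (H.op 1 0 (-1) 0)) = f := by
  rw [mixFactor]
  split_ifs with hi
  · rw [ContinuousLinearMap.comp_id, h.c10_comp_op_of_one]
    simp
  · rw [h.comp_J.c10_comp_op_of_neg_one]
    ext v
    simp [H.J_sq]

theorem IsPure.comp_mixFactor {H : QuatStr E} {f : E →L[ℝ] ℂ} (h : H.IsPure 1 f) (p i : ℕ) :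
    H.IsPure (if i < p then 1 else -1) (f.comp (H.mixFactor p i)) := by
  rw [mixFactor]
  split_ifs with hi
  · exact h
  · exact h.comp_J

theorem IsType.sub {H : QuatStr E} {p q : ℕ} {ξ η : CForm E k} (h : H.IsType p q ξ)
    (h' : H.IsType p q η) : H.IsType p q (ξ - η) :=
  ⟨h.1, Submodule.sub_mem (H.weightSpace k _) h.2 h'.2⟩

variable [FiniteDimensional ℝ E]

/-- The form `(k,0)`-part of the action of the quaternion `1 - J`; on forms of type `(p,q)`
this is the operator `R`. -/
def rho (k : ℕ) : CForm E k →ₗ[ℂ] CForm E k :=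
  (H.weightProjL k k).comp (pullL k (H.op 1 0 (-1) 0))

theorem weightProj_top_pull_dec (A : E →L[ℝ] E) (c : Fin k → E →L[ℝ] ℂ) :
    H.weightProj k (pull A (dec c)) = dec fun i => H.c10 ((c i).comp A) := by
  rw [pull_dec, weightProj_top_dec]

theorem rho_dec (c : Fin k → E →L[ℝ] ℂ) :
    H.rho k (dec c) = dec fun i => H.c10 ((c i).comp (H.op 1 0 (-1) 0)) :=
  H.weightProj_top_pull_dec _ c

theorem isType_rho (ξ : CForm E k) : H.IsType k 0 (H.rho k ξ) :=
  ⟨rfl, by simpa [rho] using H.hasWeight_weightProj (k : ℤ) (pull (H.op 1 0 (-1) 0) ξ)⟩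

/-- On products of `1`-forms, both the pull-back and the projection to top weight act on each factor
separately. -/
theorem rho_wedge {k l : ℕ} (a : CForm E k) (b : CForm E l) :
    H.rho (k + l) (wedge a b) = wedge (H.rho k a) (H.rho l b) := by
  have h := wedge_eq_of_dec ((wedgeL E k l).compr₂ (H.rho (k + l)))
    ((wedgeL E k l).compl₁₂ (H.rho k) (H.rho l)) fun a b => by
      simp only [LinearMap.compr₂_apply, LinearMap.compl₁₂_apply, wedgeL_apply, rho_dec, wedge_dec]
      congr 1
      funext i
      refine Fin.addCases (fun i => ?_) (fun i => ?_) i <;> simp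
  exact congrArg (fun F => F a b) h

/-- Up to a scalar, all quaternions produce the same (k,0)-part from a form of type (p,q): each of
the p factors of type (1,0) contributes a + bi, and each of the q factors of type (0,1) contributes
-(c + di), relative to 1 - J. -/
theorem IsType.weightProj_pull_op {H : QuatStr E} {p q : ℕ} {ξ : CForm E k} (h : H.IsType p q ξ)
    (a b c d : ℝ) : H.weightProj k (pull (H.op a b c d) ξ) =
      (((a : ℂ) + b * Complex.I) ^ p * (-((c : ℂ) + d * Complex.I)) ^ q) • H.rho k ξ := by
  obtain ⟨hk, hw⟩ := h
  -- Being of a fixed type is not preserved by the induction over sums of products, so the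
  -- projection to the type is built into the statement.
  have key : ∀ ξ : CForm E k, (H.weightProjL k k ∘ₗ pullL k (H.op a b c d) ∘ₗ
      H.weightProjL k ((p : ℤ) - q)) ξ =
      ((((a : ℂ) + b * Complex.I) ^ p * (-((c : ℂ) + d * Complex.I)) ^ q) •
        H.rho k ∘ₗ H.weightProjL k ((p : ℤ) - q)) ξ := by
    refine H.pure_induction (fun ξ η h h' => by rw [map_add, map_add, h, h'])
      (fun r ξ h => by rw [map_smul, map_smul, h]) fun e f he hf => ?_
    simp only [LinearMap.comp_apply, LinearMap.smul_apply, weightProjL_apply, pullL_apply,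
      (H.hasWeight_dec he hf).weightProj_eq]
    split_ifs with hs
    · rw [weightProj_top_pull_dec, rho_dec]
      have h1 : ∀ i, H.c10 ((f i).comp (H.op a b c d)) =
          (if e i = 1 then ((a : ℂ) + b * Complex.I) else -((c : ℂ) + d * Complex.I)) •
            H.c10 ((f i).comp (H.op 1 0 (-1) 0)) := fun i => by
        rcases he i with hi | hi
        · have hfi := hf i
          rw [hi] at hfi
          rw [hfi.c10_comp_op_of_one, hfi.c10_comp_op_of_one, if_pos hi]
          simp
        · have hfi := hf i
          rw [hi] at hfi
          rw [hfi.c10_comp_op_of_neg_one, hfi.c10_comp_op_of_neg_one, hi, if_neg (by norm_num)]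
          push_cast
          module
      rw [funext h1]
      refine (dec.map_smul_univ _ _).trans ?_
      congr 1
      -- The exponents: the numbers of signs +1 and -1 have sum p + q and difference p - q, so they
      -- are p and q.
      have hcard := Finset.card_filter_add_card_filter_not (s := (Finset.univ : Finset (Fin k)))
        (fun i => e i = 1)
      have hsum : ∑ i, e i = ((Finset.univ.filter fun i => e i = 1).card : ℤ) -
          ((Finset.univ.filter fun i => ¬ e i = 1).card : ℤ) := by
        rw [← Finset.sum_filter_add_sum_filter_not Finset.univ (fun i => e i = 1),
          Finset.sum_congr rfl (g := fun _ => (1 : ℤ)) (fun i hi => (Finset.mem_filter.1 hi).2),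
          Finset.sum_congr rfl (g := fun _ => (-1 : ℤ)) (s₁ := Finset.univ.filter _)
            (fun i hi => (he i).resolve_left (Finset.mem_filter.1 hi).2)]
        simp [sub_eq_add_neg]
      rw [Finset.card_univ, Fintype.card_fin] at hcard
      rw [Finset.prod_ite, Finset.prod_const, Finset.prod_const]
      congr 2 <;> omega
    · have h0 := map_zero (H.weightProjL k k ∘ₗ pullL k (H.op a b c d))
      have h0' := map_zero ((((a : ℂ) + b * Complex.I) ^ p *
        (-((c : ℂ) + d * Complex.I)) ^ q) • H.rho k)
      exact h0.trans h0'.symm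
  have := key ξ
  simpa only [LinearMap.comp_apply, LinearMap.smul_apply, weightProjL_apply, pullL_apply,
    hw.weightProj_eq, if_true] using this

/-- `mix` produces a form with p factors of type (1,0) and q of type (0,1), and `rho` is a left
inverse of it. -/
theorem IsType.mix {H : QuatStr E} {p q : ℕ} (hk : p + q = k) {η : CForm E k}
    (h : H.IsType k 0 η) : H.IsType p q (H.mix p η) ∧ H.rho k (H.mix p η) = η := by
  have hη : H.weightProj k η = η := (h.2.weightProj_eq (m := (k : ℤ))).trans (if_pos (by simp))
  suffices key : ∀ ξ : CForm E k, H.HasWeight ((p : ℤ) - q) (H.mixL k p (H.weightProjL k k ξ)) ∧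
      H.rho k (H.mixL k p (H.weightProjL k k ξ)) = H.weightProjL k k ξ by
    have := key η
    rw [weightProjL_apply, hη] at this
    exact ⟨⟨hk, this.1⟩, this.2⟩
  refine H.pure_induction (fun ξ η h h' => ?_) (fun r ξ h => ?_) fun e f _ _ => ?_
  · simp only [map_add]
    exact ⟨h.1.add h'.1, congrArg₂ (· + ·) h.2 h'.2⟩
  · simp only [map_smul]
    exact ⟨h.1.smul r, congrArg (r • ·) h.2⟩
  · have hb : ∀ i, H.IsPure 1 (H.c10 (f i)) := fun i => H.isPure_c10 (f i)
    have hm : H.mixL k p (H.weightProjL k k (dec f)) = _ :=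
      (congrArg (H.mix p) (H.weightProj_top_dec f)).trans (H.mix_dec p fun i => H.c10 (f i))
    rw [hm, weightProjL_apply, weightProj_top_dec]
    constructor
    · refine (Submodule.smul_mem _ _ <| Submodule.sum_mem _ fun τ _ => Submodule.smul_mem _ _ ?_ :
        _ ∈ H.weightSpace k ((p : ℤ) - q))
      have hs : ∑ i : Fin k, (if (i : ℕ) < p then (1 : ℤ) else -1) = (p : ℤ) - q := by
        subst hk
        rw [Fin.sum_univ_add]
        simp [sub_eq_add_neg]
      rw [mem_weightSpace, ← hs]
      exact H.hasWeight_dec (fun i => by split_ifs <;> simp) fun i => (hb (τ i)).comp_mixFactor p i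
    · simp only [map_smul, map_sum, rho_dec]
      -- After unmixing, each of the k! permutations gives the same product, its sign being absorbed
      -- by reordering the factors.
      have h1 : ∀ τ : Equiv.Perm (Fin k), ((Equiv.Perm.sign τ : ℤ) : ℂ) • (dec fun i =>
          H.c10 (((H.c10 (f (τ i))).comp (H.mixFactor p i)).comp (H.op 1 0 (-1) 0))) =
          dec fun i => H.c10 (f i) := fun τ => by
        rw [funext fun i => (hb (τ i)).c10_comp_mixFactor p i]
        have h2 := dec.map_perm (fun i => H.c10 (f i)) τ
        rw [Units.smul_def, ← Int.cast_smul_eq_zsmul ℂ] at h2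
        change _ • dec ((fun i => H.c10 (f i)) ∘ τ) = _
        rw [h2, smul_smul, ← Int.cast_mul, ← Units.val_mul, Int.units_mul_self]
        simp
      rw [Finset.sum_congr rfl fun τ _ => h1 τ, Finset.sum_const, Finset.card_univ,
        Fintype.card_perm, Fintype.card_fin, ← Nat.cast_smul_eq_nsmul ℂ, smul_smul,
        inv_mul_cancel₀ (by simp [Nat.factorial_ne_zero]), one_smul]

/-- Weight projections preserve rotation invariant subspaces. -/
theorem weightProj_mem (m : ℤ) {W : Submodule ℂ (CForm E k)}
    (hW : ∀ θ : ℝ, ∀ ξ ∈ W, pull (H.rot θ) ξ ∈ W) {ξ : CForm E k} (hξ : ξ ∈ W) :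
    H.weightProj m ξ ∈ W := by
  by_contra h
  -- A functional that vanishes on W but not on the projection is contradictory: it commutes with
  -- the integral and kills the integrand.
  obtain ⟨F, hF, hF0⟩ := Submodule.exists_le_ker_of_notMem h
  refine hF ?_
  have hFinite : FiniteDimensional ℝ (CForm E k) := FiniteDimensional.complexToReal _
  let G : CForm E k →L[ℝ] ℂ := LinearMap.toContinuousLinearMap (F.restrictScalars ℝ)
  change G (H.weightProj m ξ) = 0
  rw [weightProj, map_smul, ← ContinuousLinearMap.intervalIntegral_comp_comm G
    ((H.continuous_weight_integrand m ξ).intervalIntegrable _ _)]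
  have h0 : ∀ θ : ℝ, G (Complex.exp (-(Complex.I * (m : ℂ) * (θ : ℂ))) • pull (H.rot θ) ξ) = 0 :=
    fun θ => hF0 (W.smul_mem _ (hW θ ξ hξ))
  simp only [h0, intervalIntegral.integral_zero, smul_zero]

/-- An invariant subspace contains the top-weight parts of all the translates of its elements, and a
nonzero one would violate the bound on its weights. -/
theorem weightProj_pull_eq_zero_of_mem_lowWeight {ξ : CForm E k} (hξ : ξ ∈ H.lowWeight k)
    {a b c d : ℝ} (h1 : a ^ 2 + b ^ 2 + c ^ 2 + d ^ 2 = 1) :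
    H.weightProj k (pull (H.op a b c d) ξ) = 0 := by
  suffices h : H.lowWeight k ≤ LinearMap.ker (H.weightProjL k k ∘ₗ pullL k (H.op a b c d)) from
    h hξ
  refine sSup_le fun W hW ξ hξ => ?_
  have hmem : H.weightProj k (pull (H.op a b c d) ξ) ∈ W :=
    H.weightProj_mem k (fun θ ξ hξ => hW.1 _ _ 0 0 (by simp) ξ hξ) (hW.1 a b c d h1 ξ hξ)
  by_contra h0
  exact lt_irrefl _ (hW.2 k _ hmem h0 (H.hasWeight_weightProj k _))

theorem mem_lowWeight {ξ : CForm E k}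
    (h : ∀ a b c d : ℝ, a ^ 2 + b ^ 2 + c ^ 2 + d ^ 2 = 1 →
      H.weightProj k (pull (H.op a b c d) ξ) = 0) : ξ ∈ H.lowWeight k := by
  -- W collects all forms none of whose translates has a component of weight k; it is itself one of
  -- the subspaces whose sum is `lowWeight`.
  let W : Submodule ℂ (CForm E k) := ⨅ q : {q : ℝ × ℝ × ℝ × ℝ //
      q.1 ^ 2 + q.2.1 ^ 2 + q.2.2.1 ^ 2 + q.2.2.2 ^ 2 = 1},
    LinearMap.ker (H.weightProjL k k ∘ₗ pullL k (H.op q.1.1 q.1.2.1 q.1.2.2.1 q.1.2.2.2))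
  have mem_W : ∀ {η : CForm E k}, η ∈ W ↔ ∀ a b c d : ℝ, a ^ 2 + b ^ 2 + c ^ 2 + d ^ 2 = 1 →
      H.weightProj k (pull (H.op a b c d) η) = 0 := fun {η} => by
    simp only [W, Submodule.mem_iInf, LinearMap.mem_ker]
    exact ⟨fun h a b c d h1 => h ⟨(a, b, c, d), h1⟩, fun h q => h _ _ _ _ q.2⟩
  refine (le_sSup (a := W) ⟨fun a b c d h1 η hη => ?_, fun m η hη h0 hm => ?_⟩ :
    W ≤ H.lowWeight k) (mem_W.2 h)
  · refine mem_W.2 fun a' b' c' d' h2 => ?_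
    rw [pull_pull, op_comp_op]
    refine mem_W.1 hη _ _ _ _ ?_
    calc _ = (a ^ 2 + b ^ 2 + c ^ 2 + d ^ 2) * (a' ^ 2 + b' ^ 2 + c' ^ 2 + d' ^ 2) := by ring
      _ = 1 := by rw [h1, h2, one_mul]
  · refine lt_of_le_of_ne (hm.le h0) fun hmk => h0 ?_
    subst hmk
    have hid : H.op 1 0 0 0 = ContinuousLinearMap.id ℝ E := by simp [op]
    have h1 := mem_W.1 hη 1 0 0 0 (by norm_num)
    rw [hid, show pull (ContinuousLinearMap.id ℝ E) η = η from rfl, hm.weightProj_eq,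
      if_pos rfl] at h1
    exact h1

/-- The element 1 - J is not a unit quaternion. The unit quaternion (3 + 4J)/5 replaces it: both
coefficients are nonzero, so the scalar in `IsType.weightProj_pull_op` can be cancelled. -/
theorem IsType.rho_eq_zero {H : QuatStr E} {p q : ℕ} {ξ : CForm E k} (h : H.IsType p q ξ)
    (h0 : ξ ∈ H.lowWeight k) : H.rho k ξ = 0 := by
  have h1 := h.weightProj_pull_op (3 / 5) 0 (4 / 5) 0
  rw [H.weightProj_pull_eq_zero_of_mem_lowWeight h0 (by norm_num)] at h1
  refine (smul_eq_zero.1 h1.symm).resolve_left ?_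
  norm_num

theorem IsType.mem_lowWeight {H : QuatStr E} {p q : ℕ} {ξ : CForm E k} (h : H.IsType p q ξ)
    (h0 : H.rho k ξ = 0) : ξ ∈ H.lowWeight k :=
  H.mem_lowWeight fun a b c d _ => by
    rw [h.weightProj_pull_op, h0]
    exact smul_zero (M := ℂ) (A := CForm E k) _

/-- Existence: ξ and `mix` of `rho ξ` have the same type and the same `rho`, so they differ by an
element of `lowWeight`. Uniqueness: `rho` kills such a difference and recovers η from `mix`. -/
theorem IsType.R_eq {H : QuatStr E} {p q : ℕ} {ξ : CForm E k} (h : H.IsType p q ξ) :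
    H.R p ξ = H.rho k ξ := by
  have hex : ∃ η, H.IsR p ξ η := by
    obtain ⟨h1, h2⟩ := (H.isType_rho ξ).mix h.1
    refine ⟨H.rho k ξ, H.isType_rho ξ, (h.sub h1).mem_lowWeight ?_⟩
    rw [map_sub, h2, sub_self]
  rw [R, dif_pos hex]
  obtain ⟨h1, h2⟩ := hex.choose_spec
  obtain ⟨h3, h4⟩ := h1.mix h.1
  have h5 := (h.sub h3).rho_eq_zero h2
  rw [map_sub, h4, sub_eq_zero] at h5
  exact h5.symm

end QuatStr

end OperatorR

section Duality

variable {E : Type*} [NormedAddCommGroup E] [NormedSpace ℝ E]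

/-! ### Duality and the operator `V` -/

/-- Transport along an equality of degrees, as a linear map. -/
def castDegL (E : Type*) [NormedAddCommGroup E] [NormedSpace ℝ E] {k l : ℕ} (h : k = l) :
    CForm E k →ₗ[ℂ] CForm E l where
  toFun := castDeg h
  map_add' _ _ := rfl
  map_smul' _ _ := rfl

theorem castDeg_injective {k l : ℕ} (h : k = l) :
    Function.Injective (castDeg (E := E) h) := by
  subst h
  exact fun _ _ h => h

theorem castDeg_castDeg {k l m : ℕ} (h : k = l) (h' : l = m) (ξ : CForm E k) :
    castDeg h' (castDeg h ξ) = castDeg (h.trans h') ξ := rfl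

theorem wedge_castDeg_left {k k' l : ℕ} (h : k = k') (a : CForm E k) (b : CForm E l) :
    wedge (castDeg h a) b = castDeg (by rw [h]) (wedge a b) := by
  subst h
  rfl

/-- Every injection of `Fin k` into `Fin (k + l)` extends to a permutation. -/
theorem exists_perm_castAdd_eq {k l : ℕ} {s : Fin k → Fin (k + l)} (hs : Function.Injective s) :
    ∃ σ : Equiv.Perm (Fin (k + l)), ∀ i, σ (Fin.castAdd l i) = s i := by
  classical
  let e := (Equiv.ofInjective _ (Fin.castAdd_injective k l)).symm.trans (Equiv.ofInjective s hs)
  refine ⟨Equiv.extendSubtype e, fun i => ?_⟩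
  rw [Equiv.extendSubtype_apply_of_mem e _ ⟨i, rfl⟩]
  have h : (Equiv.ofInjective _ (Fin.castAdd_injective k l)).symm
      ⟨Fin.castAdd l i, ⟨i, rfl⟩⟩ = i := Equiv.ofInjective_symm_apply _ i
  simp only [e, Equiv.trans_apply]
  rw [h]
  rfl

theorem eq_zero_of_apply_basis_eq_zero {N : ℕ} (b : Module.Basis (Fin N) ℝ E) {ξ : CForm E N}
    (h : ξ b = 0) : ξ = 0 := by
  refine ContinuousAlternatingMap.toAlternatingMap_injective (b.ext_alternating fun s hs => ?_)
  let σ : Equiv.Perm (Fin N) := Equiv.ofBijective s (Finite.injective_iff_bijective.1 hs)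
  have := ξ.toAlternatingMap.map_perm b σ
  change ξ (fun i => b (s i)) = _ • ξ b at this
  change ξ (fun i => b (s i)) = 0
  rw [this, h, smul_zero]

namespace QuatStr

variable (H : QuatStr E)

/-- The `1`-forms of type `(1,0)` or `(0,1)`, as a submodule. -/
def pureSpace (e : ℤ) : Submodule ℂ (E →L[ℝ] ℂ) where
  carrier := {c | H.IsPure e c}
  add_mem' {c c'} h h' v := by
    have h1 := h v
    have h2 := h' v
    simp only [_root_.add_apply, h1, h2]
    ring
  zero_mem' v := by simp
  smul_mem' r c h v := by
    have h1 := h v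
    simp only [_root_.smul_apply, h1, smul_eq_mul]
    ring

theorem isCompl_pureSpace : IsCompl (H.pureSpace 1) (H.pureSpace (-1)) := by
  rw [isCompl_iff, disjoint_iff, codisjoint_iff]
  constructor
  · refine eq_bot_iff.2 fun c hc => ?_
    have h1 : H.IsPure 1 c := hc.1
    rw [Submodule.mem_bot, ← h1.c10_eq, IsPure.c10_eq_zero hc.2]
  · refine eq_top_iff.2 fun c _ => ?_
    rw [← H.c10_add_c01 c]
    exact Submodule.add_mem_sup (H.isPure_c10 c) (H.isPure_c01 c)

/-- Composition with `J` exchanges the forms of type `(1,0)` and `(0,1)`. -/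
def pureSpaceEquiv : H.pureSpace 1 ≃ₗ[ℂ] H.pureSpace (-1) where
  toFun c := ⟨(c : E →L[ℝ] ℂ).comp H.J, IsPure.comp_J c.2⟩
  invFun c := ⟨-(c : E →L[ℝ] ℂ).comp H.J, (H.pureSpace 1).neg_mem (by
    have := IsPure.comp_J c.2
    rwa [neg_neg] at this)⟩
  map_add' _ _ := rfl
  map_smul' _ _ := rfl
  left_inv c := by
    ext v
    simp [H.J_sq]
  right_inv c := by
    ext v
    simp [H.J_sq]

end QuatStr

variable [FiniteDimensional ℝ E]

theorem castDeg_const0_one_wedge {k : ℕ} (ξ : CForm E k) :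
    castDeg (zero_add k) (wedge (const0 E 1) ξ) = ξ := by
  have h : castDegL E (zero_add k) ∘ₗ wedgeL E 0 k (const0 E 1) = LinearMap.id := by
    refine LinearMap.ext_on (span_decSet_eq_top k Submodule.span_univ) ?_
    rintro _ ⟨a, -, rfl⟩
    change castDeg (zero_add k) (wedge (const0 E 1) (dec a)) = dec a
    rw [const0_one_eq_dec, wedge_dec, castDeg_dec]
    congr 1
    funext i
    rw [Function.comp_apply]
    rw [show (Fin.cast (zero_add k).symm i) = Fin.natAdd 0 i from by ext; simp]
    rw [Fin.append_right]
  exact congrArg (fun F => F ξ) h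

/-- The constant is the sign of the exchange of two blocks; only its being nonzero and independent
of the forms is used later. -/
theorem exists_wedge_comm (E : Type*) [NormedAddCommGroup E] [NormedSpace ℝ E]
    [FiniteDimensional ℝ E] (k : ℕ) :
    ∃ c : ℂ, c ≠ 0 ∧ ∀ a b : CForm E k, wedge a b = c • wedge b a := by
  let σ : Equiv.Perm (Fin (k + k)) := finAddFlip
  refine ⟨((Equiv.Perm.sign σ : ℤ) : ℂ), Int.cast_ne_zero.2 (Units.ne_zero _), fun a b => ?_⟩
  have h := wedge_eq_of_dec (wedgeL E k k)
    (((Equiv.Perm.sign σ : ℤ) : ℂ) • (wedgeL E k k).flip) fun a b => by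
      simp only [LinearMap.smul_apply, LinearMap.flip_apply, wedgeL_apply, wedge_dec]
      have h2 := dec.map_perm (Fin.append b a) σ
      rw [Units.smul_def, ← Int.cast_smul_eq_zsmul ℂ] at h2
      rw [← h2]
      congr 1
      funext i
      refine Fin.addCases (fun i => ?_) (fun i => ?_) i
      · rw [Function.comp_apply, finAddFlip_apply_castAdd, Fin.append_left, Fin.append_right]
      · rw [Function.comp_apply, finAddFlip_apply_natAdd, Fin.append_left, Fin.append_right]
  exact congrArg (fun F => F a b) h

/-- If η is nonzero on k vectors of a basis, its wedge with the product of the coordinate forms dual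
to the remaining vectors is nonzero on the whole basis. -/
theorem eq_zero_of_wedge_eq_zero {k l : ℕ} (hE : Module.finrank ℝ E = k + l) {η : CForm E k}
    (h : ∀ ξ : CForm E l, wedge η ξ = 0) : η = 0 := by
  by_contra hη
  let b := Module.finBasisOfFinrankEq ℝ E hE
  obtain ⟨s, hs⟩ : ∃ s : Fin k → Fin (k + l), η (b ∘ s) ≠ 0 := by
    by_contra! hs
    have hk : (k.factorial : ℂ) ≠ 0 := by simp [Nat.factorial_ne_zero]
    refine hη ((smul_eq_zero.1 ?_).resolve_left hk)
    rw [factorial_smul_eq_sum_dec b η]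
    exact Finset.sum_eq_zero fun s _ => by rw [hs s]; exact zero_smul ℂ (_ : CForm E k)
  have hinj : Function.Injective s := by
    by_contra hs'
    refine hs (η.map_eq_zero_of_not_injective _ fun h' => hs' h'.of_comp)
  obtain ⟨σ, hσ⟩ := exists_perm_castAdd_eq hinj
  let u := b.reindex σ.symm
  have hu : ∀ i, u i = b (σ i) := fun i => by simp [u]
  let ξ : CForm E l := dec fun j => dualForm u (Fin.natAdd k j)
  have hξ : ∀ w : Fin l → Fin (k + l), ξ (fun j => u (w j)) =
      (Matrix.of fun i j => if w i = Fin.natAdd k j then (1 : ℂ) else 0).det := fun w => by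
    rw [dec_apply]
    congr 1
    ext i j
    simp only [Matrix.of_apply, dualForm_apply, Module.Basis.repr_self, Finsupp.single_apply]
    split_ifs <;> simp
  have h0 : wedge η ξ u = 0 := by rw [h ξ]; rfl
  rw [wedge_eq_domCoprod] at h0
  have hsum : (η.toAlternatingMap.domCoprod ξ.toAlternatingMap) (u ∘ finSumFinEquiv) =
      ∑ τ : Equiv.Perm.ModSumCongr (Fin k) (Fin l), AlternatingMap.domCoprod.summand
        η.toAlternatingMap ξ.toAlternatingMap τ (u ∘ finSumFinEquiv) := by
    rw [AlternatingMap.domCoprod_apply, _root_.sum_apply]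
  rw [hsum, map_sum] at h0
  -- A nontrivial shuffle feeds one of the first k basis vectors to ξ, all of whose factors vanish
  -- on it.
  have hzero : ∀ τ : Equiv.Perm.ModSumCongr (Fin k) (Fin l), τ ≠ Quotient.mk'' 1 →
      LinearMap.mul' ℝ ℂ (AlternatingMap.domCoprod.summand η.toAlternatingMap ξ.toAlternatingMap τ
        (u ∘ finSumFinEquiv)) = 0 := by
    intro τ hτ
    induction τ using Quotient.inductionOn' with | _ τ
    rw [AlternatingMap.domCoprod.summand_mk'']
    have hex : ∃ (j : Fin l) (i : Fin k), τ (Sum.inr j) = Sum.inl i := by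
      by_contra! hne
      have hr : ∀ j, ∃ j', τ (Sum.inr j) = Sum.inr j' := fun j => by
        rcases hj : τ (Sum.inr j) with i | j'
        · exact absurd hj (hne j i)
        · exact ⟨j', rfl⟩
      choose t ht using hr
      have tinj : Function.Injective t := fun x y hxy => by
        have : τ (Sum.inr x) = τ (Sum.inr y) := by rw [ht, ht, hxy]
        simpa using this
      refine hτ (Quotient.sound' ?_)
      rw [QuotientGroup.leftRel_apply, mul_one]
      refine Subgroup.inv_mem _ (Equiv.Perm.mem_sumCongrHom_range_of_perm_mapsTo_inl ?_)
      rintro _ ⟨i, rfl⟩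
      rcases hi : τ (Sum.inl i) with i' | j
      · exact ⟨i', rfl⟩
      · obtain ⟨x, rfl⟩ := (Finite.injective_iff_surjective.1 tinj) j
        rw [← ht] at hi
        simp at hi
    obtain ⟨j, i, hij⟩ := hex
    have hz : ξ (fun j => u (finSumFinEquiv (τ (Sum.inr j)))) = 0 := by
      rw [hξ]
      refine Matrix.det_eq_zero_of_row_eq_zero j fun j' => ?_
      rw [Matrix.of_apply, hij, if_neg]
      rw [finSumFinEquiv_apply_left]
      exact fun h => by
        have := congrArg Fin.val h
        simp at this
        omega
    rw [_root_.smul_apply, MultilinearMap.domDomCongr_apply,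
      MultilinearMap.domCoprod_apply, Units.smul_def, map_zsmul, LinearMap.mul'_apply]
    change _ • (_ * ξ (fun j => u (finSumFinEquiv (τ (Sum.inr j))))) = _
    rw [hz, mul_zero, smul_zero]
  replace h0 := (Finset.sum_eq_single _ (fun τ _ hτ => hzero τ hτ) (by simp)).symm.trans h0
  rw [AlternatingMap.domCoprod.summand_mk''] at h0
  simp only [Equiv.Perm.sign_one, one_smul, MultilinearMap.domDomCongr_apply,
    Equiv.Perm.one_apply, MultilinearMap.domCoprod_apply, LinearMap.mul'_apply] at h0
  rcases mul_eq_zero.1 h0 with h1 | h1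
  · refine hs ?_
    rw [← h1]
    change _ = η (fun i => u (finSumFinEquiv (Sum.inl i)))
    congr 1
    funext i
    simp [hu, hσ]
  · change ξ (fun j => u (finSumFinEquiv (Sum.inr j))) = 0 at h1
    rw [hξ] at h1
    have : (Matrix.of fun i j : Fin l => if finSumFinEquiv (Sum.inr i : Fin k ⊕ Fin l) =
        Fin.natAdd k j then (1 : ℂ) else 0) = 1 := by
      ext i j
      simp [Matrix.one_apply]
    rw [this, Matrix.det_one] at h1
    exact one_ne_zero h1

/-- The wedge product is a perfect pairing in complementary degrees. -/
theorem exists_wedge_eq {k : ℕ} (hE : Module.finrank ℝ E = k + k)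
    (L : CForm E k →ₗ[ℂ] CForm E (k + k)) : ∃ v : CForm E k, ∀ ξ, wedge v ξ = L ξ := by
  let b := Module.finBasisOfFinrankEq ℝ E hE
  let ev : CForm E (k + k) →ₗ[ℂ] ℂ :=
    { toFun := fun ξ => ξ b, map_add' := fun _ _ => rfl, map_smul' := fun _ _ => rfl }
  -- Evaluation on a basis is injective on top-degree forms, so the pairing can be taken with values
  -- in ℂ and an injection into the dual is onto by dimension.
  let B : CForm E k →ₗ[ℂ] Module.Dual ℂ (CForm E k) := (wedgeL E k k).compr₂ ev
  have hB : Function.Injective B := by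
    refine (injective_iff_map_eq_zero B).2 fun v hv => eq_zero_of_wedge_eq_zero hE fun ξ => ?_
    exact eq_zero_of_apply_basis_eq_zero b (congrArg (fun F => F ξ) hv)
  obtain ⟨v, hv⟩ := (LinearMap.injective_iff_surjective_of_finrank_eq_finrank
    Subspace.dual_finrank_eq.symm).1 hB (ev ∘ₗ L)
  refine ⟨v, fun ξ => sub_eq_zero.1 (eq_zero_of_apply_basis_eq_zero b ?_)⟩
  have := congrArg (fun F => F ξ) hv
  change wedge v ξ b = L ξ b at this
  rw [ContinuousAlternatingMap.sub_apply, this, sub_self]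

namespace QuatStr

variable (H : QuatStr E)

/-- Weights add under the wedge product, so a factor of weight 0 commutes with the projection. -/
theorem HasWeight.weightProj_zero_wedge {H : QuatStr E} {k l : ℕ} {ξ : CForm E l}
    (hξ : H.HasWeight 0 ξ) (v : CForm E k) :
    H.weightProj 0 (HKT.wedge v ξ) = HKT.wedge (H.weightProj 0 v) ξ := by
  have key : ∀ v : CForm E k, (H.weightProjL (k + l) 0 ∘ₗ (wedgeL E k l).flip ξ) v =
      ((wedgeL E k l).flip ξ ∘ₗ H.weightProjL k 0) v := by
    refine H.pure_induction (fun v w h h' => by rw [map_add, map_add, h, h'])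
      (fun r v h => by rw [map_smul, map_smul, h]) fun e a he ha => ?_
    have hw := H.hasWeight_dec he ha
    have hw' := hw.wedge hξ
    rw [add_zero] at hw'
    change H.weightProj 0 (HKT.wedge (dec a) ξ) = (wedgeL E k l).flip ξ (H.weightProj 0 (dec a))
    rw [hw'.weightProj_eq, hw.weightProj_eq]
    split_ifs
    · rfl
    · rw [map_zero]
  exact key v

/-- Removes from the definition of V(1) the factor 1, the transports of degree and the choice in
`R`. -/
theorem isV_one_iff {n : ℕ} {Θ : CForm E (2 * n)} {v : CForm E (2 * n)} :
    H.IsV (n := n) (p := 0) (Nat.zero_le n) Θ (const0 E 1) v ↔ H.IsType n n v ∧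
      ∀ ξ : CForm E (2 * n), H.IsType n n ξ →
        wedge v ξ = wedge (H.rho (2 * n) ξ) (conj Θ) := by
  refine and_congr Iff.rfl (forall_congr' fun ξ => forall_congr' fun hξ => ?_)
  have h1 : wedge (H.rho (2 * n) ξ) (conj Θ) =
      castDeg (by omega) (wedge (wedge (const0 E 1) (H.R n ξ)) (conj Θ)) := by
    have hR : H.R n ξ = H.rho (2 * n) ξ := IsType.R_eq (k := 2 * n) (p := n) (q := n) hξ
    rw [hR, ← castDeg_const0_one_wedge (H.rho (2 * n) ξ), wedge_castDeg_left,
      castDeg_const0_one_wedge]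
  rw [h1]
  change castDeg _ (wedge v ξ) = castDeg _ (wedge (wedge (const0 E 1) (H.R n ξ)) (conj Θ)) ↔ _
  rw [← (castDeg_injective (E := E) (show 2 * n + 2 * n = 4 * n by omega)).eq_iff, castDeg_castDeg]

/-- The perfect pairing represents ξ ↦ R(ξ) ∧ conj Θ by some form v, and its part of weight 0 is the
one sought: against ξ of type (n,n) it still works, since R(ξ) ∧ conj Θ has weight 2n - 2n = 0. -/
theorem exists_isV_one {n : ℕ} (hE : Module.finrank ℝ E = 4 * n) {Θ : CForm E (2 * n)}
    (hΘ : H.IsType (2 * n) 0 Θ) :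
    ∃ v, H.IsV (n := n) (p := 0) (Nat.zero_le n) Θ (const0 E 1) v := by
  obtain ⟨v, hv⟩ := exists_wedge_eq (k := 2 * n) (by omega)
    ((wedgeL E (2 * n) (2 * n)).flip (conj Θ) ∘ₗ H.rho (2 * n))
  refine ⟨H.weightProj 0 v, H.isV_one_iff.2 ⟨⟨by omega, ?_⟩, fun ξ hξ => ?_⟩⟩
  · simpa using H.hasWeight_weightProj 0 v
  · have h0 : H.HasWeight 0 ξ := by simpa using hξ.2
    rw [← h0.weightProj_zero_wedge, hv]
    have hw := (H.isType_rho ξ).2.wedge hΘ.2.conj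
    rw [add_neg_cancel] at hw
    exact hw.weightProj_eq.trans (if_pos rfl)

/-- The complex-valued `1`-forms have complex dimension 4n and split into two types, which J
exchanges. -/
theorem finrank_pureSpace_one {n : ℕ} (hE : Module.finrank ℝ E = 4 * n) :
    Module.finrank ℂ (H.pureSpace 1) = 2 * n := by
  let e : (E →ₗ[ℝ] ℂ) ≃ₗ[ℂ] (E →L[ℝ] ℂ) :=
    { LinearMap.toContinuousLinearMap with map_smul' := fun _ _ => rfl }
  have hfin : FiniteDimensional ℂ (E →L[ℝ] ℂ) := Module.Finite.equiv e
  have h1 : Module.finrank ℂ (E →L[ℝ] ℂ) = 4 * n := by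
    rw [← hE, ← Module.finrank_linearMap_self ℝ ℂ E, e.finrank_eq]
  have h2 := Submodule.finrank_add_eq_of_isCompl H.isCompl_pureSpace
  have h3 := H.pureSpaceEquiv.finrank_eq
  omega

/-- The forms of type `(2n,0)` are the multiples of the product of a basis of the `(1,0)`-forms. -/
theorem exists_smul_dec_eq {n : ℕ} (b : Module.Basis (Fin n) ℂ (H.pureSpace 1)) {η : CForm E n}
    (hη : H.IsType n 0 η) : ∃ r : ℂ, η = r • dec fun i => (b i : E →L[ℝ] ℂ) := by
  have hw : H.weightProj n η = η := (hη.2.weightProj_eq (m := (n : ℤ))).trans (if_pos (by simp))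
  rw [← hw]
  refine H.pure_induction (p := fun ξ => ∃ r : ℂ, H.weightProj n ξ =
    r • dec fun i => (b i : E →L[ℝ] ℂ)) (fun ξ ξ' => ?_) (fun c ξ => ?_) (fun e a _ _ => ?_) η
  · rintro ⟨r, hr⟩ ⟨r', hr'⟩
    refine ⟨r + r', ?_⟩
    rw [← weightProjL_apply, map_add, weightProjL_apply, weightProjL_apply, hr, hr']
    exact (add_smul _ _ _).symm
  · rintro ⟨r, hr⟩
    refine ⟨c * r, ?_⟩
    rw [← weightProjL_apply, map_smul, weightProjL_apply, hr, smul_smul]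
  · let c : Fin n → H.pureSpace 1 := fun i => ⟨H.c10 (a i), H.isPure_c10 _⟩
    -- The coefficient is the determinant of the (1,0)-parts in the basis, since every alternating
    -- map in n factors is a multiple of the determinant.
    refine ⟨b.det c, ?_⟩
    rw [weightProj_top_dec]
    ext v
    let ev : CForm E n →ₗ[ℂ] ℂ :=
      { toFun := fun ξ => ξ v, map_add' := fun _ _ => rfl, map_smul' := fun _ _ => rfl }
    let F : (H.pureSpace 1) [⋀^Fin n]→ₗ[ℂ] ℂ :=
      ev.compAlternatingMap (dec.compLinearMap (H.pureSpace 1).subtype)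
    have h := @AlternatingMap.eq_smul_basis_det ℂ _ (H.pureSpace 1) _ _ (Fin n) _ _ b F
    have h' := congrArg (fun F => F c) h
    change dec (fun i => H.c10 (a i)) v = dec (fun i => (b i : E →L[ℝ] ℂ)) v * b.det c at h'
    rw [h', mul_comm]
    rfl

/-- By nondegeneracy it suffices that η ∧ ξ = 0 for products ξ of pure factors. A (1,0)-factor in ξ
is dependent on the 2n factors of η; without one, ξ is of type (0,2n), hence a multiple of conj Θ.
-/
theorem eq_zero_of_wedge_conj_eq_zero {n : ℕ} (hE : Module.finrank ℝ E = 4 * n)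
    {η Θ : CForm E (2 * n)} (hη : H.IsType (2 * n) 0 η) (hΘ : H.IsType (2 * n) 0 Θ) (hΘ0 : Θ ≠ 0)
    (h : wedge η (conj Θ) = 0) : η = 0 := by
  let e : (E →ₗ[ℝ] ℂ) ≃ₗ[ℂ] (E →L[ℝ] ℂ) :=
    { LinearMap.toContinuousLinearMap with map_smul' := fun _ _ => rfl }
  have hfin : FiniteDimensional ℂ (E →L[ℝ] ℂ) := Module.Finite.equiv e
  have hfree : Module.Free ℂ (H.pureSpace 1) := Module.Free.of_divisionRing ℂ (H.pureSpace 1)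
  have hfin' : Module.Finite ℂ (H.pureSpace 1) := FiniteDimensional.finiteDimensional_submodule _
  let b := Module.finBasisOfFinrankEq ℂ (H.pureSpace 1) (H.finrank_pureSpace_one hE)
  obtain ⟨y, hy⟩ := H.exists_smul_dec_eq b hΘ
  have hy0 : y ≠ 0 := by
    rintro rfl
    exact hΘ0 (hy.trans (zero_smul ℂ (_ : CForm E (2 * n))))
  refine eq_zero_of_wedge_eq_zero (l := 2 * n) (by omega) fun ξ => ?_
  obtain ⟨x, rfl⟩ := H.exists_smul_dec_eq b hη
  refine H.pure_induction (p := fun ξ => wedge (x • dec fun i => (b i : E →L[ℝ] ℂ)) ξ = 0)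
    (fun ξ ξ' h h' => ?_) (fun c ξ h => ?_) (fun e a he ha => ?_) ξ
  · rw [← wedgeL_apply, map_add, wedgeL_apply, wedgeL_apply, h, h']
    exact add_zero (0 : CForm E (2 * n + 2 * n))
  · rw [← wedgeL_apply, map_smul, wedgeL_apply, h]
    exact smul_zero (M := ℂ) (A := CForm E (2 * n + 2 * n)) c
  · by_cases hex : ∃ j, e j = 1
    · obtain ⟨j, hj⟩ := hex
      have haj := ha j
      rw [hj] at haj
      have hdep : ¬ LinearIndependent ℂ (Fin.append (fun i => (b i : E →L[ℝ] ℂ)) a) := fun hli => by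
        refine hli.notMem_span_image (s := Set.range (Fin.castAdd (2 * n)))
          (x := Fin.natAdd (2 * n) j) ?_ ?_
        · rintro ⟨i, hi⟩
          have := congrArg Fin.val hi
          simp at this
          omega
        · rw [← Set.range_comp, Fin.append_right]
          have h1 : Fin.append (fun i => (b i : E →L[ℝ] ℂ)) a ∘ Fin.castAdd (2 * n) =
              (H.pureSpace 1).subtype ∘ b := funext fun i => Fin.append_left _ _ i
          rw [h1, Set.range_comp, Submodule.span_image, b.span_eq, Submodule.map_top,
            Submodule.range_subtype]
          exact haj
      rw [← wedgeL_apply, map_smul, LinearMap.smul_apply, wedgeL_apply, wedge_dec,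
        AlternatingMap.map_linearDependent _ _ hdep]
      exact smul_zero (M := ℂ) (A := CForm E (2 * n + 2 * n)) x
    · push Not at hex
      have hneg : ∀ i, e i = -1 := fun i => (he i).resolve_left (hex i)
      have hw : H.IsType (2 * n) 0 (conj (dec a)) := by
        refine ⟨rfl, ?_⟩
        have := (H.hasWeight_dec he ha).conj
        simpa [hneg] using this
      obtain ⟨z, hz⟩ := H.exists_smul_dec_eq b hw
      have hda : dec a = ((starRingEnd ℂ) (z / y)) • conj Θ := by
        have h1 : conj (dec a) = (z / y) • Θ := by
          rw [hz, hy, smul_smul, div_mul_cancel₀ _ hy0]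
        ext v
        have h2 := congrArg (fun ξ : CForm E (2 * n) => (starRingEnd ℂ) (ξ v)) h1
        change (starRingEnd ℂ) ((starRingEnd ℂ) (dec a v)) = (starRingEnd ℂ) (z / y * Θ v) at h2
        rw [Complex.conj_conj, map_mul] at h2
        exact h2
      rw [hda, ← wedgeL_apply, map_smul, wedgeL_apply, h]
      exact smul_zero (M := ℂ) (A := CForm E (2 * n + 2 * n)) _

end QuatStr

end Duality

section Powers

variable {E : Type*} [NormedAddCommGroup E] [NormedSpace ℝ E]

/-! ### Powers of `2`-forms and the pointwise equivalence -/

theorem wpow_smul (c : ℂ) (α : CForm E 2) (m : ℕ) : wpow (c • α) m = c ^ m • wpow α m := by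
  induction m with
  | zero => exact ((pow_zero c).symm ▸ one_smul ℂ (wpow α 0)).symm
  | succ m ih =>
    change wedge (wpow (c • α) m) (c • α) = c ^ (m + 1) • wedge (wpow α m) α
    rw [ih, ← wedgeL_apply, map_smul, map_smul, LinearMap.smul_apply, smul_smul, pow_succ']
    rfl

namespace QuatStr

variable {H : QuatStr E}

theorem hasWeight_const0 (H : QuatStr E) (c : ℂ) : H.HasWeight 0 (const0 E c) := fun θ => by
  ext v
  change c = Complex.exp (Complex.I * ((0 : ℤ) : ℂ) * θ) * c
  simp

theorem HasWeight.wpow {m : ℤ} {α : CForm E 2} (h : H.HasWeight m α) (j : ℕ) :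
    H.HasWeight (j * m) (wpow α j) := by
  induction j with
  | zero =>
    rw [Nat.cast_zero, zero_mul]
    exact H.hasWeight_const0 1
  | succ j ih =>
    have := ih.wedge h
    rw [show (j : ℤ) * m + m = ((j + 1 : ℕ) : ℤ) * m by push_cast; ring] at this
    exact this

variable [FiniteDimensional ℝ E]

theorem rho_wpow (H : QuatStr E) (α : CForm E 2) (j : ℕ) :
    H.rho (2 * j) (wpow α j) = wpow (H.rho 2 α) j := by
  induction j with
  | zero =>
    change H.rho 0 (const0 E 1) = const0 E 1
    rw [const0_one_eq_dec, rho_dec]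
    congr 1
    exact funext fun i => i.elim0
  | succ j ih =>
    refine (H.rho_wedge (wpow α j) α).trans ?_
    rw [ih]
    rfl

/-- At a point, the equation `(Ω')^n = r Ω^n` is equivalent to `(κ')^n ∧ Φ = r κ^n ∧ Φ` if
`R κ = -√-1 Ω` and `R κ' = -√-1 Ω'`. -/
theorem wpow_eq_smul_iff {n : ℕ} (hE : Module.finrank ℝ E = 4 * n) {Θ Φ : CForm E (2 * n)}
    (hΘ : H.IsType (2 * n) 0 Θ) (hΘ0 : Θ ≠ 0)
    (hΦ : H.IsV (n := n) (p := 0) (Nat.zero_le n) Θ (const0 E 1) Φ) {κ κ' Ω Ω' : CForm E 2}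
    (hκ : H.HasWeight 0 κ) (hκ' : H.HasWeight 0 κ') (hΩ : H.rho 2 κ = (-Complex.I) • Ω)
    (hΩ' : H.rho 2 κ' = (-Complex.I) • Ω') (r : ℂ) :
    wpow Ω' n = r • wpow Ω n ↔ wedge (wpow κ' n) Φ = r • wedge (wpow κ n) Φ := by
  obtain ⟨c, hc, hcomm⟩ := exists_wedge_comm E (2 * n)
  obtain ⟨-, hΦ⟩ := H.isV_one_iff.1 hΦ
  have hI : (-Complex.I) ^ n ≠ 0 := pow_ne_zero _ (neg_ne_zero.2 Complex.I_ne_zero)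
  -- Used for both pairs: α^n ∧ Φ is, up to order, R(α^n) ∧ conj Θ, and the constant that arises
  -- does not depend on the pair.
  have hα : ∀ {α A : CForm E 2}, H.HasWeight 0 α → H.rho 2 α = (-Complex.I) • A →
      H.IsType (2 * n) 0 (wpow A n) ∧
        wedge (wpow α n) Φ = (c * (-Complex.I) ^ n) • wedge (wpow A n) (conj Θ) := by
    intro α A h hA
    have hrho : H.rho (2 * n) (wpow α n) = (-Complex.I) ^ n • wpow A n := by
      rw [rho_wpow, hA, wpow_smul]
    constructor
    · have h1 := (H.isType_rho (wpow α n)).2.smul ((-Complex.I) ^ n)⁻¹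
      rw [hrho, inv_smul_smul₀ hI] at h1
      exact ⟨rfl, h1⟩
    · have ht : H.IsType n n (wpow α n) := ⟨by omega, by simpa using h.wpow n⟩
      rw [hcomm, hΦ _ ht, hrho, ← wedgeL_apply, map_smul, LinearMap.smul_apply, smul_smul]
      rfl
  obtain ⟨h1, h2⟩ := hα hκ hΩ
  obtain ⟨h1', h2'⟩ := hα hκ' hΩ'
  rw [h2, h2', smul_comm r]
  rw [(smul_right_injective (CForm E (2 * n + 2 * n)) (mul_ne_zero hc hI)).eq_iff]
  constructor
  · intro h
    rw [h, ← wedgeL_apply, map_smul]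
    rfl
  · intro h
    have h3 : H.IsType (2 * n) 0 (wpow Ω' n - r • wpow Ω n) := h1'.sub ⟨h1.1, h1.2.smul r⟩
    refine sub_eq_zero.1 (H.eq_zero_of_wedge_conj_eq_zero hE h3 hΘ hΘ0 ?_)
    rw [← wedgeL_apply, map_sub, map_smul, LinearMap.sub_apply, LinearMap.smul_apply,
      wedgeL_apply, wedgeL_apply, h]
    exact sub_self (r • wedge (wpow Ω n) (conj Θ))

/-! ### Weight components of `2`-forms -/

/-- The (1,0)-projection (1 - √-1 I)/2 applied in both arguments. -/
theorem weightProj_two_apply (H : QuatStr E) (β : CForm E 2) (v w : E) :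
    H.weightProj 2 β ![v, w] = 4⁻¹ * (β ![v, w] - Complex.I * β ![H.I v, w] -
      Complex.I * β ![v, H.I w] - β ![H.I v, H.I w]) := by
  have key : ∀ β : CForm E 2, H.weightProjL 2 2 β ![v, w] = 4⁻¹ * (β ![v, w] -
      Complex.I * β ![H.I v, w] - Complex.I * β ![v, H.I w] - β ![H.I v, H.I w]) := by
    refine H.pure_induction (fun ξ η h h' => ?_) (fun c ξ h => ?_) fun e a he ha => ?_
    · rw [map_add, ContinuousAlternatingMap.add_apply, h, h']
      simp only [ContinuousAlternatingMap.add_apply]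
      ring
    · rw [map_smul, ContinuousAlternatingMap.smul_apply, h]
      simp only [ContinuousAlternatingMap.smul_apply, smul_eq_mul]
      ring
    · change H.weightProj ((2 : ℕ) : ℤ) (dec a) ![v, w] = _
      rw [weightProj_top_dec]
      simp only [dec_apply, Matrix.det_fin_two, Matrix.of_apply, c10_apply, Matrix.cons_val_zero,
        Matrix.cons_val_one]
      linear_combination (4⁻¹ * (a 0 (H.I v) * a 1 (H.I w) - a 1 (H.I v) * a 0 (H.I w))) *
        Complex.I_mul_I
  exact key β

/-- Applying I to both arguments is 1 on weight 0 and -1 on weights 2 and -2, so averaging isolates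
weight 0. -/
theorem weightProj_zero_apply (H : QuatStr E) (β : CForm E 2) (v w : E) :
    H.weightProj 0 β ![v, w] = 2⁻¹ * (β ![v, w] + β ![H.I v, H.I w]) := by
  have key : ∀ β : CForm E 2, H.weightProjL 2 0 β ![v, w] =
      2⁻¹ * (β ![v, w] + β ![H.I v, H.I w]) := by
    refine H.pure_induction (fun ξ η h h' => ?_) (fun c ξ h => ?_) fun e a he ha => ?_
    · rw [map_add, ContinuousAlternatingMap.add_apply, h, h']
      simp only [ContinuousAlternatingMap.add_apply]
      ring
    · rw [map_smul, ContinuousAlternatingMap.smul_apply, h]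
      simp only [ContinuousAlternatingMap.smul_apply, smul_eq_mul]
      ring
    · rw [weightProjL_apply, (H.hasWeight_dec he ha).weightProj_eq]
      have h0 := ha 0
      have h1 := ha 1
      simp only [dec_apply, Matrix.det_fin_two, Matrix.of_apply, Fin.sum_univ_two,
        Matrix.cons_val_zero, Matrix.cons_val_one, h0 v, h0 w, h1 v, h1 w]
      rcases he 0 with e0 | e0 <;> rcases he 1 with e1 | e1 <;> rw [e0, e1]
      · rw [if_neg (by norm_num)]
        push_cast
        change (0 : ℂ) = _
        linear_combination (-2⁻¹ * (a 0 v * a 1 w - a 1 v * a 0 w)) * Complex.I_mul_I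
      · rw [if_pos (by norm_num), dec_apply, Matrix.det_fin_two]
        push_cast
        simp only [Matrix.of_apply, Matrix.cons_val_zero, Matrix.cons_val_one]
        linear_combination (2⁻¹ * (a 0 v * a 1 w - a 1 v * a 0 w)) * Complex.I_mul_I
      · rw [if_pos (by norm_num), dec_apply, Matrix.det_fin_two]
        push_cast
        simp only [Matrix.of_apply, Matrix.cons_val_zero, Matrix.cons_val_one]
        linear_combination (2⁻¹ * (a 0 v * a 1 w - a 1 v * a 0 w)) * Complex.I_mul_I
      · rw [if_neg (by norm_num)]
        push_cast
        change (0 : ℂ) = _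
        linear_combination (-2⁻¹ * (a 0 v * a 1 w - a 1 v * a 0 w)) * Complex.I_mul_I
  exact key β

theorem weightProj_neg_one_apply (H : QuatStr E) (β : CForm E 1) (v : E) :
    H.weightProj (-1) β ![v] = 2⁻¹ * (β ![v] + Complex.I * β ![H.I v]) := by
  have key : ∀ β : CForm E 1, H.weightProjL 1 (-1) β ![v] =
      2⁻¹ * (β ![v] + Complex.I * β ![H.I v]) := by
    refine H.pure_induction (fun ξ η h h' => ?_) (fun c ξ h => ?_) fun e a he ha => ?_
    · rw [map_add, ContinuousAlternatingMap.add_apply, h, h']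
      simp only [ContinuousAlternatingMap.add_apply]
      ring
    · rw [map_smul, ContinuousAlternatingMap.smul_apply, h]
      simp only [ContinuousAlternatingMap.smul_apply, smul_eq_mul]
      ring
    · rw [weightProjL_apply, (H.hasWeight_dec he ha).weightProj_eq]
      have h0 := ha 0
      simp only [dec_apply, Matrix.det_fin_one, Matrix.of_apply, Fin.sum_univ_one,
        Matrix.cons_val_zero, h0 v]
      rcases he 0 with e0 | e0 <;> rw [e0]
      · rw [if_neg (by norm_num)]
        push_cast
        change (0 : ℂ) = _
        linear_combination (-2⁻¹ * a 0 v) * Complex.I_mul_I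
      · rw [if_pos (by norm_num), dec_apply, Matrix.det_fin_one]
        push_cast
        simp only [Matrix.of_apply, Matrix.cons_val_zero]
        linear_combination (2⁻¹ * a 0 v) * Complex.I_mul_I
  exact key β

end QuatStr

end Powers

section Nijenhuis

variable {E : Type*} [NormedAddCommGroup E] [NormedSpace ℝ E]

/-! ### The Nijenhuis tensor and second derivatives in coordinates -/

/-- The Nijenhuis tensor of a field of endomorphisms of a vector space with value `A` and
derivative `DA` at a point. -/
def nijenhuis (A : E →L[ℝ] E) (DA : E →L[ℝ] E →L[ℝ] E) (v w : E) : E :=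
  DA (A v) w - DA (A w) v + A (DA w v) - A (DA v w)

/-- The differential of the `1`-form `dφ ∘ A`, where `S` and `L` are the second and first
derivatives of `φ`. -/
def dForm₂ (S : E →L[ℝ] E →L[ℝ] ℝ) (L : E →L[ℝ] ℝ) (A : E →L[ℝ] E) (DA : E →L[ℝ] E →L[ℝ] E)
    (v w : E) : ℝ :=
  S v (A w) + L (DA v w) - (S w (A v) + L (DA w v))

/-- The polarised Nijenhuis tensor of A and C = BA equals B applied to N_B(A·, A·) - N_C + N_A, so
it vanishes with the three tensors. -/
theorem nijenhuis_mixed {A B C : E →L[ℝ] E} {DA DB DC : E →L[ℝ] E →L[ℝ] E}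
    (hB : ∀ v, B (B v) = -v) (hC : ∀ v, C v = B (A v))
    (dC : ∀ u v, DC u v = DB u (A v) + B (DA u v))
    (NA : ∀ v w, nijenhuis A DA v w = 0) (NB : ∀ v w, nijenhuis B DB v w = 0)
    (NC : ∀ v w, nijenhuis C DC v w = 0) (v w : E) :
    DA (C v) w - DA (C w) v + DC (A v) w - DC (A w) v + A (DC w v) + C (DA w v) - A (DC v w)
      - C (DA v w) = 0 := by
  have h1 := congrArg B (NC v w)
  have h2 := congrArg B (NB (A v) (A w))
  have h3 := congrArg B (NA v w)
  simp only [nijenhuis, dC, hC, hB, map_add, map_sub, map_zero] at h1 h2 h3 ⊢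
  have h := congrArg₂ (· + ·) (congrArg₂ (· - ·) h2 h1) h3
  simp only [sub_zero, add_zero] at h
  rw [← h]
  abel

/-- The terms in S match by symmetry. The terms in L differ by L applied to A N_A, after
differentiating A² = -1. -/
theorem dForm₂_invariant {S : E →L[ℝ] E →L[ℝ] ℝ} (hS : ∀ v w, S v w = S w v) (L : E →L[ℝ] ℝ)
    {A : E →L[ℝ] E} {DA : E →L[ℝ] E →L[ℝ] E} (hA : ∀ v, A (A v) = -v)
    (dA : ∀ u v, DA u (A v) + A (DA u v) = 0) (NA : ∀ v w, nijenhuis A DA v w = 0) (v w : E) :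
    dForm₂ S L A DA (A v) (A w) = dForm₂ S L A DA v w := by
  have h1 := congrArg (fun u => L (A u)) (NA v w)
  have h2 := congrArg L (dA (A v) w)
  have h3 := congrArg L (dA (A w) v)
  simp only [nijenhuis, dForm₂, hA, map_add, map_sub, map_neg, map_zero] at h1 h2 h3 ⊢
  rw [hS (A v) w, hS (A w) v]
  linarith

/-- The terms in S cancel by symmetry and anticommutation. The first-order terms reduce to L of the
mixed tensor of A and B and of BA applied to N_A. -/
theorem dForm₂_anticommuting {S : E →L[ℝ] E →L[ℝ] ℝ} (hS : ∀ v w, S v w = S w v) (L : E →L[ℝ] ℝ)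
    {A B C : E →L[ℝ] E} {DA DB DC : E →L[ℝ] E →L[ℝ] E}
    (hA : ∀ v, A (A v) = -v) (hB : ∀ v, B (B v) = -v) (hC : ∀ v, C v = B (A v))
    (hAB : ∀ v, A (B v) = -C v)
    (dA : ∀ u v, DA u (A v) + A (DA u v) = 0)
    (dC : ∀ u v, DC u v = DB u (A v) + B (DA u v))
    (dAB : ∀ u v, DA u (B v) + A (DB u v) = -DC u v)
    (NA : ∀ v w, nijenhuis A DA v w = 0) (NB : ∀ v w, nijenhuis B DB v w = 0)
    (NC : ∀ v w, nijenhuis C DC v w = 0) (v w : E) :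
    dForm₂ S L A DA (B v) w + dForm₂ S L A DA v (B w) =
      dForm₂ S L C DC (A v) (A w) - dForm₂ S L C DC v w := by
  have hdA : ∀ u v, DA u (A v) = -A (DA u v) := fun u v => eq_neg_of_add_eq_zero_left (dA u v)
  -- The triple (A, -C, B) is admissible because B = (-C)A; it yields the mixed tensor of A and B.
  -- The sign is harmless, as the Nijenhuis tensor is quadratic.
  have hM := nijenhuis_mixed (A := A) (B := -C) (C := B) (DA := DA) (DB := -DC) (DC := DB)
    (fun v => by
      have h : C (C v) = -v := by rw [hC (C v), ← neg_neg (C v), ← hAB, map_neg, hA, neg_neg, hB]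
      simpa using h)
    (fun v => by simp [hC, hA])
    (fun u v => by
      simp only [_root_.neg_apply, dC u (A v), hA, hdA, map_neg, hC]
      abel)
    NA
    (fun v w => by
      have := NC v w
      simp only [nijenhuis, _root_.neg_apply, map_neg, neg_neg] at this ⊢
      rw [← this])
    NB v w
  have h1 := congrArg L hM
  have h2 := congrArg (fun u => L (B (A u))) (NA v w)
  have e1 := congrArg L (dC (A v) (A w))
  have e2 := congrArg L (dC (A w) (A v))
  have e3 := congrArg L (dAB v w)
  have e4 := congrArg L (dAB w v)
  simp only [nijenhuis, dForm₂, hC, hA, hAB, hdA, map_add, map_sub, map_neg, map_zero]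
    at h1 h2 e1 e2 e3 e4 ⊢
  rw [hS (B v) (A w), hS (B w) (A v)]
  linarith

end Nijenhuis

section Charts

variable {E : Type*} [NormedAddCommGroup E] [NormedSpace ℝ E]
  {M : Type*} [TopologicalSpace M] [ChartedSpace E M] [IsManifold 𝓘(ℝ, E) ∞ M]

/-! ### Calculus in charts -/

/-- The derivative of the inverse of the chart at `x₀`. -/
def chartInvDeriv (x₀ : M) (y : E) : E →L[ℝ] E :=
  mfderiv 𝓘(ℝ, E) 𝓘(ℝ, E) (extChartAt 𝓘(ℝ, E) x₀).symm y

/-- The derivative of the chart at `x₀`. -/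
def chartDeriv (x₀ z : M) : E →L[ℝ] E :=
  mfderiv 𝓘(ℝ, E) 𝓘(ℝ, E) (extChartAt 𝓘(ℝ, E) x₀) z

theorem chartDeriv_chartInvDeriv (x₀ : M) {y : E} (hy : y ∈ (extChartAt 𝓘(ℝ, E) x₀).target)
    (v : E) : chartDeriv x₀ ((extChartAt 𝓘(ℝ, E) x₀).symm y) (chartInvDeriv x₀ y v) = v := by
  have h := mfderiv_extChartAt_comp_mfderivWithin_extChartAt_symm (I := 𝓘(ℝ, E)) hy
  rw [ModelWithCorners.range_eq_univ, mfderivWithin_univ] at h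
  exact congrArg (fun F : E →L[ℝ] E => F v) h

theorem chartInvDeriv_chartDeriv (x₀ : M) {y : E} (hy : y ∈ (extChartAt 𝓘(ℝ, E) x₀).target)
    (v : E) : chartInvDeriv x₀ y (chartDeriv x₀ ((extChartAt 𝓘(ℝ, E) x₀).symm y) v) = v := by
  have h := mfderivWithin_extChartAt_symm_comp_mfderiv_extChartAt (I := 𝓘(ℝ, E)) hy
  rw [ModelWithCorners.range_eq_univ, mfderivWithin_univ] at h
  exact congrArg (fun F : E →L[ℝ] E => F v) h

omit [IsManifold 𝓘(ℝ, E) ∞ M] in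
theorem target_mem_nhds (x₀ : M) :
    (extChartAt 𝓘(ℝ, E) x₀).target ∈ nhds (extChartAt 𝓘(ℝ, E) x₀ x₀) :=
  extChartAt_target_mem_nhds x₀

/-- The coordinate expression of a field of endomorphisms. -/
def coordEnd (A : M → E →L[ℝ] E) (x₀ : M) (y : E) : E →L[ℝ] E :=
  (chartDeriv x₀ ((extChartAt 𝓘(ℝ, E) x₀).symm y)).comp
    ((A ((extChartAt 𝓘(ℝ, E) x₀).symm y)).comp (chartInvDeriv x₀ y))

omit [IsManifold 𝓘(ℝ, E) ∞ M] in
theorem coordEnd_apply (A : M → E →L[ℝ] E) (x₀ : M) (y v : E) :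
    coordEnd A x₀ y v = chartDeriv x₀ ((extChartAt 𝓘(ℝ, E) x₀).symm y)
      (A ((extChartAt 𝓘(ℝ, E) x₀).symm y) (chartInvDeriv x₀ y v)) := rfl

/-- The trivialisation of the Hom bundle used in `IsSmoothEnd` conjugates by the derivative of the
chart, which is `coordEnd`. -/
theorem differentiableAt_coordEnd {A : M → E →L[ℝ] E} (hA : IsSmoothEnd A) (x₀ : M) :
    DifferentiableAt ℝ (coordEnd A x₀) (extChartAt 𝓘(ℝ, E) x₀ x₀) := by
  have h1 := ((contMDiffAt_hom_bundle _).1 (hA x₀)).2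
  have h2 : ContMDiffAt 𝓘(ℝ, E) 𝓘(ℝ, E →L[ℝ] E) ∞ (fun z : M =>
      ((chartDeriv x₀ z).comp ((A z).comp (chartInvDeriv x₀ (extChartAt 𝓘(ℝ, E) x₀ z))) :
        E →L[ℝ] E)) x₀ := by
    refine h1.congr_of_eventuallyEq ?_
    filter_upwards [chart_source_mem_nhds E x₀] with z hz
    have h := inTangentCoordinates_eq_mfderiv_comp (I := 𝓘(ℝ, E)) (I' := 𝓘(ℝ, E))
      (f := fun z : M => z) (g := fun z : M => z) (ϕ := fun z => A z) (x₀ := x₀) (x := z) hz hz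
    rw [ModelWithCorners.range_eq_univ, mfderivWithin_univ] at h
    exact h.symm
  have h3 : ContMDiffAt 𝓘(ℝ, E) 𝓘(ℝ, E) ∞ (extChartAt 𝓘(ℝ, E) x₀).symm
      (extChartAt 𝓘(ℝ, E) x₀ x₀) :=
    (contMDiffOn_extChartAt_symm x₀).contMDiffAt (target_mem_nhds x₀)
  have h4 := ContMDiffAt.comp_of_eq h2 h3 (extChartAt_to_inv x₀)
  have h5 := h4.contDiffAt.differentiableAt (by simp)
  refine h5.congr_of_eventuallyEq ?_
  filter_upwards [target_mem_nhds x₀] with y hy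
  simp only [Function.comp_apply]
  rw [(extChartAt 𝓘(ℝ, E) x₀).right_inv hy]
  rfl

theorem coordEnd_comp {A B C : M → E →L[ℝ] E} (h : ∀ x v, A x (B x v) = C x v) (x₀ : M) {y : E}
    (hy : y ∈ (extChartAt 𝓘(ℝ, E) x₀).target) (v : E) :
    coordEnd A x₀ y (coordEnd B x₀ y v) = coordEnd C x₀ y v := by
  simp only [coordEnd_apply, chartInvDeriv_chartDeriv x₀ hy, h]

omit [IsManifold 𝓘(ℝ, E) ∞ M] in
theorem coordEnd_neg (A : M → E →L[ℝ] E) (x₀ : M) (y v : E) :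
    coordEnd (fun x => -A x) x₀ y v = -coordEnd A x₀ y v := by
  simp [coordEnd_apply]

theorem coordEnd_id (x₀ : M) {y : E} (hy : y ∈ (extChartAt 𝓘(ℝ, E) x₀).target) (v : E) :
    coordEnd (fun _ => ContinuousLinearMap.id ℝ E) x₀ y v = v :=
  chartDeriv_chartInvDeriv x₀ hy v

/-- The derivative of the coordinate expression of a field of endomorphisms. -/
def coordEndDeriv (A : M → E →L[ℝ] E) (x₀ : M) : E →L[ℝ] E →L[ℝ] E :=
  fderiv ℝ (coordEnd A x₀) (extChartAt 𝓘(ℝ, E) x₀ x₀)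

theorem coordEndDeriv_comp {A B C : M → E →L[ℝ] E} (hA : IsSmoothEnd A) (hB : IsSmoothEnd B)
    (h : ∀ x v, A x (B x v) = C x v) (x₀ : M) (u v : E) :
    coordEndDeriv C x₀ u v =
      coordEndDeriv A x₀ u (coordEnd B x₀ (extChartAt 𝓘(ℝ, E) x₀ x₀) v) +
        coordEnd A x₀ (extChartAt 𝓘(ℝ, E) x₀ x₀) (coordEndDeriv B x₀ u v) := by
  have h1 := ((differentiableAt_coordEnd hA x₀).hasFDerivAt.clm_comp
    (differentiableAt_coordEnd hB x₀).hasFDerivAt)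
  have h2 : (fun y => (coordEnd A x₀ y).comp (coordEnd B x₀ y)) =ᶠ[nhds
      (extChartAt 𝓘(ℝ, E) x₀ x₀)] coordEnd C x₀ := by
    filter_upwards [target_mem_nhds x₀] with y hy
    exact ContinuousLinearMap.ext fun v => coordEnd_comp h x₀ hy v
  have h3 := (h1.congr_of_eventuallyEq h2.symm).fderiv
  rw [coordEndDeriv, h3]
  simp [coordEndDeriv, add_comm]

omit [IsManifold 𝓘(ℝ, E) ∞ M] in
theorem coordEndDeriv_neg (A : M → E →L[ℝ] E) (x₀ : M) (u v : E) :
    coordEndDeriv (fun x => -A x) x₀ u v = -coordEndDeriv A x₀ u v := by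
  have h : coordEnd (fun x => -A x) x₀ = -coordEnd A x₀ :=
    funext fun y => ContinuousLinearMap.ext fun v => coordEnd_neg A x₀ y v
  rw [coordEndDeriv, h, fderiv_neg]
  rfl

theorem coordEndDeriv_id (x₀ : M) :
    coordEndDeriv (fun _ : M => ContinuousLinearMap.id ℝ E) x₀ = 0 := by
  have h : coordEnd (fun _ : M => ContinuousLinearMap.id ℝ E) x₀ =ᶠ[nhds
      (extChartAt 𝓘(ℝ, E) x₀ x₀)] fun _ => ContinuousLinearMap.id ℝ E := by
    filter_upwards [target_mem_nhds x₀] with y hy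
    exact ContinuousLinearMap.ext fun v => coordEnd_id x₀ hy v
  rw [coordEndDeriv, h.fderiv_eq, fderiv_fun_const]
  rfl

theorem differentiableAt_coordEnd_id (x₀ : M) :
    DifferentiableAt ℝ (coordEnd (fun _ : M => ContinuousLinearMap.id ℝ E) x₀)
      (extChartAt 𝓘(ℝ, E) x₀ x₀) := by
  refine (differentiableAt_const (ContinuousLinearMap.id ℝ E)).congr_of_eventuallyEq ?_
  filter_upwards [target_mem_nhds x₀] with y hy
  exact ContinuousLinearMap.ext fun v => coordEnd_id x₀ hy v

theorem inverse_chartDeriv (x₀ : M) {y : E} (hy : y ∈ (extChartAt 𝓘(ℝ, E) x₀).target) :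
    (chartDeriv x₀ ((extChartAt 𝓘(ℝ, E) x₀).symm y)).inverse = chartInvDeriv x₀ y :=
  ContinuousLinearMap.inverse_eq (ContinuousLinearMap.ext fun v => chartDeriv_chartInvDeriv x₀ hy v)
    (ContinuousLinearMap.ext fun v => chartInvDeriv_chartDeriv x₀ hy v)

theorem inverse_chartInvDeriv (x₀ : M) {y : E} (hy : y ∈ (extChartAt 𝓘(ℝ, E) x₀).target) :
    (chartInvDeriv x₀ y).inverse = chartDeriv x₀ ((extChartAt 𝓘(ℝ, E) x₀).symm y) :=
  ContinuousLinearMap.inverse_eq (ContinuousLinearMap.ext fun v => chartInvDeriv_chartDeriv x₀ hy v)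
    (ContinuousLinearMap.ext fun v => chartDeriv_chartInvDeriv x₀ hy v)

theorem chartInvDeriv_chartDeriv_self (x₀ : M) (v : E) :
    chartInvDeriv x₀ (extChartAt 𝓘(ℝ, E) x₀ x₀) (chartDeriv x₀ x₀ v) = v := by
  have h := chartInvDeriv_chartDeriv x₀ (mem_extChartAt_target (I := 𝓘(ℝ, E)) x₀) v
  rwa [extChartAt_to_inv] at h

theorem chartDeriv_end (A : M → E →L[ℝ] E) (x₀ : M) (v : E) :
    chartDeriv x₀ x₀ (A x₀ v) =
      coordEnd A x₀ (extChartAt 𝓘(ℝ, E) x₀ x₀) (chartDeriv x₀ x₀ v) := by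
  rw [coordEnd_apply, chartInvDeriv_chartDeriv_self, extChartAt_to_inv]

theorem fderiv_coordEnd_apply {A : M → E →L[ℝ] E} (hs : IsSmoothEnd A) (x₀ : M) (u v : E) :
    fderiv ℝ (fun y => coordEnd A x₀ y v) (extChartAt 𝓘(ℝ, E) x₀ x₀) u =
      coordEndDeriv A x₀ u v := by
  rw [((differentiableAt_coordEnd hs x₀).hasFDerivAt.clm_apply (hasFDerivAt_const v _)).fderiv]
  simp [coordEndDeriv]

/-! ### Lie brackets in a chart and the coordinate form of integrability. -/

section Bracket

/-- The vector field with constant coordinates `v` in the chart at `x₀`. -/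
def constField (x₀ : M) (v : E) (z : M) : TangentSpace 𝓘(ℝ, E) z :=
  VectorField.mpullback 𝓘(ℝ, E) 𝓘(ℝ, E) (extChartAt 𝓘(ℝ, E) x₀) (fun _ => v) z

theorem constField_symm (x₀ : M) (v : E) {y : E} (hy : y ∈ (extChartAt 𝓘(ℝ, E) x₀).target) :
    constField x₀ v ((extChartAt 𝓘(ℝ, E) x₀).symm y) = chartInvDeriv x₀ y v :=
  DFunLike.congr_fun (F := E →L[ℝ] E) (inverse_chartDeriv x₀ hy) v

theorem bracketAt_eq (x₀ : M) {X Y : (y : M) → TangentSpace 𝓘(ℝ, E) y} {F G : E → E}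
    (hX : ∀ y ∈ (extChartAt 𝓘(ℝ, E) x₀).target,
      X ((extChartAt 𝓘(ℝ, E) x₀).symm y) = chartInvDeriv x₀ y (F y))
    (hY : ∀ y ∈ (extChartAt 𝓘(ℝ, E) x₀).target,
      Y ((extChartAt 𝓘(ℝ, E) x₀).symm y) = chartInvDeriv x₀ y (G y)) :
    chartDeriv x₀ x₀ (bracketAt X Y x₀) =
      VectorField.lieBracket ℝ F G (extChartAt 𝓘(ℝ, E) x₀ x₀) := by
  have hpull : ∀ {Z : (y : M) → TangentSpace 𝓘(ℝ, E) y} {P : E → E},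
      (∀ y ∈ (extChartAt 𝓘(ℝ, E) x₀).target,
        Z ((extChartAt 𝓘(ℝ, E) x₀).symm y) = chartInvDeriv x₀ y (P y)) →
      (fun y => VectorField.mpullbackWithin 𝓘(ℝ, E) 𝓘(ℝ, E) (extChartAt 𝓘(ℝ, E) x₀).symm Z
        (Set.range 𝓘(ℝ, E)) y : E → E) =ᶠ[nhds (extChartAt 𝓘(ℝ, E) x₀ x₀)] P := by
    intro Z P hZ
    filter_upwards [target_mem_nhds x₀] with y hy
    rw [ModelWithCorners.range_eq_univ, VectorField.mpullbackWithin_apply, mfderivWithin_univ,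
      hZ y hy]
    change (chartInvDeriv x₀ y).inverse (chartInvDeriv x₀ y (P y)) = P y
    rw [inverse_chartInvDeriv x₀ hy, chartDeriv_chartInvDeriv x₀ hy]
  have h1 : bracketAt X Y x₀ = (chartDeriv x₀ x₀).inverse (VectorField.lieBracketWithin ℝ
      (fun y => VectorField.mpullbackWithin 𝓘(ℝ, E) 𝓘(ℝ, E) (extChartAt 𝓘(ℝ, E) x₀).symm X
        (Set.range 𝓘(ℝ, E)) y : E → E)
      (fun y => VectorField.mpullbackWithin 𝓘(ℝ, E) 𝓘(ℝ, E) (extChartAt 𝓘(ℝ, E) x₀).symm Y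
        (Set.range 𝓘(ℝ, E)) y : E → E)
      ((extChartAt 𝓘(ℝ, E) x₀).symm ⁻¹' Set.univ ∩ Set.range 𝓘(ℝ, E))
      (extChartAt 𝓘(ℝ, E) x₀ x₀)) := rfl
  have h2 : (chartDeriv x₀ x₀).inverse = chartInvDeriv x₀ (extChartAt 𝓘(ℝ, E) x₀ x₀) := by
    have h := inverse_chartDeriv x₀ (mem_extChartAt_target (I := 𝓘(ℝ, E)) x₀)
    rwa [extChartAt_to_inv] at h
  have h3 : ∀ v, chartDeriv x₀ x₀ (chartInvDeriv x₀ (extChartAt 𝓘(ℝ, E) x₀ x₀) v) = v := by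
    have h := chartDeriv_chartInvDeriv x₀ (mem_extChartAt_target (I := 𝓘(ℝ, E)) x₀)
    rwa [extChartAt_to_inv] at h
  have h4 : ∀ P Q : E → E, VectorField.lieBracketWithin ℝ P Q
      ((extChartAt 𝓘(ℝ, E) x₀).symm ⁻¹' Set.univ ∩ Set.range 𝓘(ℝ, E)) =
        VectorField.lieBracket ℝ P Q := fun P Q => by
    rw [Set.preimage_univ, Set.univ_inter, ModelWithCorners.range_eq_univ,
      VectorField.lieBracketWithin_univ]
  rw [h1, h2, h3]
  exact (congrFun (h4 _ _) _).trans ((hpull hX).lieBracket_vectorField_eq (hpull hY))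

variable [CompleteSpace E]

theorem contMDiffAt_constField (x₀ : M) (v : E) :
    ContMDiffAt 𝓘(ℝ, E) 𝓘(ℝ, E).tangent ∞
      (fun y => (⟨y, constField x₀ v y⟩ : TangentBundle 𝓘(ℝ, E) M)) x₀ := by
  refine ContMDiffAt.mpullback_vectorField_preimage (n := ∞) ?_
    (contMDiffAt_extChartAt) (isInvertible_mfderiv_extChartAt (mem_extChartAt_source x₀)) (by simp)
  exact contMDiffAt_vectorSpace_iff_contDiffAt.2 contDiffAt_const

/-- Tested on fields with constant coordinates, the brackets reduce to derivatives of the coordinate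
matrix of A. -/
theorem IsIntegrable.nijenhuis_eq_zero {A : M → E →L[ℝ] E} (hA : IsIntegrable A)
    (hs : IsSmoothEnd A) (x₀ : M) (v w : E) :
    nijenhuis (coordEnd A x₀ (extChartAt 𝓘(ℝ, E) x₀ x₀)) (coordEndDeriv A x₀) v w = 0 := by
  have h := congrArg (chartDeriv x₀ x₀) (hA x₀ (constField x₀ v) (constField x₀ w)
    (contMDiffAt_constField x₀ v) (contMDiffAt_constField x₀ w))
  have hc : ∀ u : E, ∀ y ∈ (extChartAt 𝓘(ℝ, E) x₀).target,
      constField x₀ u ((extChartAt 𝓘(ℝ, E) x₀).symm y) = chartInvDeriv x₀ y u :=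
    fun u y hy => constField_symm x₀ u hy
  have hAc : ∀ u : E, ∀ y ∈ (extChartAt 𝓘(ℝ, E) x₀).target,
      A ((extChartAt 𝓘(ℝ, E) x₀).symm y) (constField x₀ u ((extChartAt 𝓘(ℝ, E) x₀).symm y)) =
        chartInvDeriv x₀ y (coordEnd A x₀ y u) := fun u y hy => by
    rw [coordEnd_apply, chartInvDeriv_chartDeriv x₀ hy]
    exact congrArg _ (hc u y hy)
  have e1 := bracketAt_eq (X := fun y => A y (constField x₀ v y)) (Y := fun y => A y (constField x₀ w y))
    (F := fun y => coordEnd A x₀ y v) (G := fun y => coordEnd A x₀ y w) x₀ (hAc v) (hAc w)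
  have e2 := bracketAt_eq (X := fun y => A y (constField x₀ v y)) (Y := constField x₀ w)
    (F := fun y => coordEnd A x₀ y v) (G := fun _ => w) x₀ (hAc v) (hc w)
  have e3 := bracketAt_eq (X := constField x₀ v) (Y := fun y => A y (constField x₀ w y))
    (F := fun _ => v) (G := fun y => coordEnd A x₀ y w) x₀ (hc v) (hAc w)
  have e4 := bracketAt_eq (X := constField x₀ v) (Y := constField x₀ w)
    (F := fun _ => v) (G := fun _ => w) x₀ (hc v) (hc w)
  simp only [VectorField.lieBracket_eq, fderiv_coordEnd_apply hs, fderiv_fun_const, Pi.zero_apply,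
    _root_.zero_apply, sub_zero, zero_sub] at e1 e2 e3 e4
  rw [map_sub, map_sub, map_sub, map_zero, chartDeriv_end A, chartDeriv_end A] at h
  rw [nijenhuis, ← h]
  refine Eq.trans ?_ (congrArg₂ (· - ·) (congrArg₂ (· - ·) (congrArg₂ (· - ·) e1
    (congrArg _ e2)) (congrArg _ e3)) e4).symm
  simp

end Bracket

end Charts

section Functions

variable {E : Type*} [NormedAddCommGroup E] [NormedSpace ℝ E]
  {M : Type*} [TopologicalSpace M] [ChartedSpace E M]

/-! ### Differential forms built from the differential of a function -/

/-- The coordinate expression of a function. -/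
def coordFun (φ : M → ℝ) (x₀ : M) (y : E) : ℝ := φ ((extChartAt 𝓘(ℝ, E) x₀).symm y)

/-- The differential of a function. -/
def differential (E : Type*) [NormedAddCommGroup E] [NormedSpace ℝ E] {M : Type*}
    [TopologicalSpace M] [ChartedSpace E M] (φ : M → ℝ) (z : M) : E →L[ℝ] ℝ :=
  mfderiv 𝓘(ℝ, E) 𝓘(ℝ, ℝ) φ z

theorem dForm_ofFun_apply' (φ : M → ℝ) (z : M) (v : E) :
    dForm (ofFun E φ) z ![v] =
      fderiv ℝ (fun y : E => (coordFun φ z y : ℂ)) (extChartAt 𝓘(ℝ, E) z z) (chartDeriv z z v) := by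
  have h : extDeriv (chartRep (ofFun E φ) z) (extChartAt 𝓘(ℝ, E) z z) =
      .ofSubsingleton _ _ _ (0 : Fin 1)
        (fderiv ℝ (fun y : E => (coordFun φ z y : ℂ)) (extChartAt 𝓘(ℝ, E) z z)) := by
    rw [← extDeriv_constOfIsEmpty]
    congr 1
  rw [dForm, h]
  rfl

variable [IsManifold 𝓘(ℝ, E) ∞ M]

theorem contDiffAt_coordFun {φ : M → ℝ} (hφ : ContMDiff 𝓘(ℝ, E) 𝓘(ℝ, ℝ) ∞ φ) (x₀ : M) {y : E}
    (hy : y ∈ (extChartAt 𝓘(ℝ, E) x₀).target) : ContDiffAt ℝ ∞ (coordFun φ x₀) y := by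
  have h3 : ContMDiffAt 𝓘(ℝ, E) 𝓘(ℝ, E) ∞ (extChartAt 𝓘(ℝ, E) x₀).symm y :=
    (contMDiffOn_extChartAt_symm x₀).contMDiffAt ((isOpen_extChartAt_target x₀).mem_nhds hy)
  exact (hφ.contMDiffAt.comp y h3).contDiffAt

theorem differential_symm_apply {φ : M → ℝ} (hφ : ContMDiff 𝓘(ℝ, E) 𝓘(ℝ, ℝ) ∞ φ) (x₀ : M) {y : E}
    (hy : y ∈ (extChartAt 𝓘(ℝ, E) x₀).target) (v : E) :
    differential E φ ((extChartAt 𝓘(ℝ, E) x₀).symm y) v =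
      fderiv ℝ (coordFun φ x₀) y (chartDeriv x₀ ((extChartAt 𝓘(ℝ, E) x₀).symm y) v) := by
  have h3 : ContMDiffAt 𝓘(ℝ, E) 𝓘(ℝ, E) ∞ (extChartAt 𝓘(ℝ, E) x₀).symm y :=
    (contMDiffOn_extChartAt_symm x₀).contMDiffAt ((isOpen_extChartAt_target x₀).mem_nhds hy)
  have h : fderiv ℝ (coordFun φ x₀) y =
      (differential E φ ((extChartAt 𝓘(ℝ, E) x₀).symm y)).comp (chartInvDeriv x₀ y) := by
    rw [← mfderiv_eq_fderiv]
    exact mfderiv_comp y (hφ.mdifferentiable (by simp) _) (h3.mdifferentiableAt (by simp))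
  rw [h, ContinuousLinearMap.comp_apply, chartInvDeriv_chartDeriv x₀ hy]

theorem dForm_ofFun_apply {φ : M → ℝ} (hφ : ContMDiff 𝓘(ℝ, E) 𝓘(ℝ, ℝ) ∞ φ) (z : M) (v : E) :
    dForm (ofFun E φ) z ![v] = (differential E φ z v : ℂ) := by
  have h := differential_symm_apply hφ z (mem_extChartAt_target (I := 𝓘(ℝ, E)) z) v
  rw [extChartAt_to_inv] at h
  rw [dForm_ofFun_apply', h]
  have h2 := Complex.ofRealCLM.hasFDerivAt.comp (extChartAt 𝓘(ℝ, E) z z)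
    ((contDiffAt_coordFun hφ z (mem_extChartAt_target z)).differentiableAt (by simp)).hasFDerivAt
  exact congrArg (fun F : E →L[ℝ] ℂ => F (chartDeriv z z v)) h2.fderiv

/-- The exterior derivative at `x` of the `1`-form `dφ ∘ A`, as a real bilinear form. -/
def twistedHessian (φ : M → ℝ) (A : M → E →L[ℝ] E) (x : M) (v w : E) : ℝ :=
  dForm₂ (fderiv ℝ (fderiv ℝ (coordFun φ x)) (extChartAt 𝓘(ℝ, E) x x))
    (fderiv ℝ (coordFun φ x) (extChartAt 𝓘(ℝ, E) x x))
    (coordEnd A x (extChartAt 𝓘(ℝ, E) x x)) (coordEndDeriv A x)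
    (chartDeriv x x v) (chartDeriv x x w)

theorem two_le_infty : (2 : ℕ∞ω) ≤ ∞ := by
  have h : ((2 : ℕ∞) : ℕ∞ω) ≤ ((⊤ : ℕ∞) : ℕ∞ω) := WithTop.coe_le_coe.2 le_top
  exact h

theorem fderiv_fderiv_coordFun_symm {φ : M → ℝ} (hφ : ContMDiff 𝓘(ℝ, E) 𝓘(ℝ, ℝ) ∞ φ) (x : M)
    (v w : E) :
    fderiv ℝ (fderiv ℝ (coordFun φ x)) (extChartAt 𝓘(ℝ, E) x x) v w =
      fderiv ℝ (fderiv ℝ (coordFun φ x)) (extChartAt 𝓘(ℝ, E) x x) w v :=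
  ((contDiffAt_coordFun hφ x (mem_extChartAt_target x)).isSymmSndFDerivAt (by simpa using two_le_infty)).eq v w

theorem twistedHessian_id {φ : M → ℝ} (hφ : ContMDiff 𝓘(ℝ, E) 𝓘(ℝ, ℝ) ∞ φ) (x : M) (v w : E) :
    twistedHessian φ (fun _ => ContinuousLinearMap.id ℝ E) x v w = 0 := by
  have h := fun v => coordEnd_id (M := M) x (mem_extChartAt_target (I := 𝓘(ℝ, E)) x) v
  rw [twistedHessian, dForm₂, coordEndDeriv_id, h, h, fderiv_fderiv_coordFun_symm hφ]
  simp

/-- One computation for both potentials: ∂̄φ is the case of id and I, ∂_Jφ that of J and K. -/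
theorem dForm_apply {φ : M → ℝ} (hφ : ContMDiff 𝓘(ℝ, E) 𝓘(ℝ, ℝ) ∞ φ) (x : M)
    {A B : M → E →L[ℝ] E}
    (hA : DifferentiableAt ℝ (coordEnd A x) (extChartAt 𝓘(ℝ, E) x x))
    (hB : DifferentiableAt ℝ (coordEnd B x) (extChartAt 𝓘(ℝ, E) x x)) (a b : ℂ) {α : DForm E M 1}
    (hα : ∀ z v, α z ![v] = a * (differential E φ z (A z v) : ℂ) +
      b * (differential E φ z (B z v) : ℂ)) (v w : E) :
    dForm α x ![v, w] = a * (twistedHessian φ A x v w : ℂ) + b * (twistedHessian φ B x v w : ℂ) := by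
  set y₀ := extChartAt 𝓘(ℝ, E) x x with hy₀
  let P (y : E) : E →L[ℝ] ℂ :=
    a • Complex.ofRealCLM.comp ((fderiv ℝ (coordFun φ x) y).comp (coordEnd A x y)) +
      b • Complex.ofRealCLM.comp ((fderiv ℝ (coordFun φ x) y).comp (coordEnd B x y))
  have hL : DifferentiableAt ℝ (fderiv ℝ (coordFun φ x)) y₀ :=
    ((contDiffAt_coordFun hφ x (mem_extChartAt_target x)).fderiv_right (m := 1)
      (by simpa [one_add_one_eq_two] using two_le_infty)).differentiableAt (by simp)
  have hP : DifferentiableAt ℝ P y₀ := by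
    have hc : ∀ {A : M → E →L[ℝ] E}, DifferentiableAt ℝ (coordEnd A x) y₀ →
        DifferentiableAt ℝ (fun y => (Complex.ofRealCLM.comp
          ((fderiv ℝ (coordFun φ x) y).comp (coordEnd A x y)) : E →L[ℝ] ℂ)) y₀ := fun h =>
      (differentiableAt_const _).clm_comp (hL.clm_comp h)
    exact ((hc hA).const_smul a).add ((hc hB).const_smul b)
  have hd : ∀ u t : E, fderiv ℝ (fun y => P y t) y₀ u =
      a * ((fderiv ℝ (fderiv ℝ (coordFun φ x)) y₀ u (coordEnd A x y₀ t) +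
        fderiv ℝ (coordFun φ x) y₀ (coordEndDeriv A x u t) : ℝ) : ℂ) +
      b * ((fderiv ℝ (fderiv ℝ (coordFun φ x)) y₀ u (coordEnd B x y₀ t) +
        fderiv ℝ (coordFun φ x) y₀ (coordEndDeriv B x u t) : ℝ) : ℂ) := by
    intro u t
    have hc : ∀ {A : M → E →L[ℝ] E}, DifferentiableAt ℝ (coordEnd A x) y₀ →
        HasFDerivAt (fun y => fderiv ℝ (coordFun φ x) y (coordEnd A x y t)) _ y₀ := fun h =>
      hL.hasFDerivAt.clm_apply (h.hasFDerivAt.clm_apply (hasFDerivAt_const t y₀))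
    have h := ((Complex.ofRealCLM.hasFDerivAt.comp y₀ (hc hA)).const_mul a).add
      ((Complex.ofRealCLM.hasFDerivAt.comp y₀ (hc hB)).const_mul b)
    refine (congrArg (fun F : E →L[ℝ] ℂ => F u) h.fderiv).trans ?_
    have hD : ∀ A : M → E →L[ℝ] E, fderiv ℝ (coordEnd A x) y₀ = coordEndDeriv A x := fun A => rfl
    simp [hD]
    ring
  -- By the chain rule the chart representative of α is P near the point, so its exterior derivative
  -- can be read off from the derivative of P.
  have hrep : chartRep α x =ᶠ[nhds y₀] fun y =>
      ContinuousAlternatingMap.ofSubsingleton ℝ E ℂ (0 : Fin 1) (P y) := by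
    filter_upwards [target_mem_nhds x] with y hy
    ext v
    obtain ⟨v, rfl⟩ : ∃ u : E, v = ![u] := ⟨v 0, by ext i; fin_cases i; rfl⟩
    have hu : (fun i => chartInvDeriv x y (![v] i)) = ![chartInvDeriv x y v] := by
      ext i
      fin_cases i
      rfl
    refine (congrArg (α ((extChartAt 𝓘(ℝ, E) x).symm y)) hu).trans ((hα _ _).trans ?_)
    rw [differential_symm_apply hφ x hy, differential_symm_apply hφ x hy]
    rfl
  have hQ : DifferentiableAt ℝ
      (fun y => ContinuousAlternatingMap.ofSubsingleton ℝ E ℂ (0 : Fin 1) (P y)) y₀ :=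
    (ContinuousAlternatingMap.ofSubsingletonLIE (𝕜 := ℝ) (E := E) (F := ℂ)
      (0 : Fin 1)).toContinuousLinearEquiv.differentiableAt.comp y₀ hP
  have h := extDeriv_apply hQ ![chartDeriv x x v, chartDeriv x x w]
  rw [Fin.sum_univ_two] at h
  have hv : (fun i => chartDeriv x x (![v, w] i)) = ![chartDeriv x x v, chartDeriv x x w] := by
    ext i
    fin_cases i <;> rfl
  rw [dForm, hrep.extDeriv_eq]
  change extDeriv _ y₀ (fun i => chartDeriv x x (![v, w] i)) = _
  rw [hv, h]
  have e1 := hd (chartDeriv x x v) (chartDeriv x x w)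
  have e2 := hd (chartDeriv x x w) (chartDeriv x x v)
  refine (congrArg₂ (fun s t : ℂ => (-1) ^ 0 • s + (-1) ^ 1 • t) e1 e2).trans ?_
  simp only [twistedHessian, dForm₂, ← hy₀, pow_zero, pow_one, one_smul, neg_smul]
  push_cast
  ring

end Functions

/-! ### Symmetries of the forms d(dφ ∘ A) on the manifold. -/

section Twisted

variable {E : Type*} [NormedAddCommGroup E] [NormedSpace ℝ E]
  {M : Type*} [TopologicalSpace M] [ChartedSpace E M] [IsManifold 𝓘(ℝ, E) ∞ M]

theorem coordEnd_mul_self {A : M → E →L[ℝ] E} (hA : ∀ x v, A x (A x v) = -v) (x : M) (v : E) :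
    coordEnd A x (extChartAt 𝓘(ℝ, E) x x) (coordEnd A x (extChartAt 𝓘(ℝ, E) x x) v) = -v := by
  have hx := mem_extChartAt_target (I := 𝓘(ℝ, E)) x
  rw [coordEnd_comp (C := fun _ => -ContinuousLinearMap.id ℝ E) (by simpa using hA) x hx,
    coordEnd_neg, coordEnd_id x hx]

theorem coordEndDeriv_mul_self {A : M → E →L[ℝ] E} (hs : IsSmoothEnd A)
    (hA : ∀ x v, A x (A x v) = -v) (x : M) (u v : E) :
    coordEndDeriv A x u (coordEnd A x (extChartAt 𝓘(ℝ, E) x x) v) +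
      coordEnd A x (extChartAt 𝓘(ℝ, E) x x) (coordEndDeriv A x u v) = 0 := by
  rw [← coordEndDeriv_comp (C := fun _ => -ContinuousLinearMap.id ℝ E) hs hs (by simpa using hA) x,
    coordEndDeriv_neg, coordEndDeriv_id]
  simp

omit [IsManifold 𝓘(ℝ, E) ∞ M] in
theorem twistedHessian_neg (φ : M → ℝ) (A : M → E →L[ℝ] E) (x : M) (v w : E) :
    twistedHessian φ A x (-v) w = -twistedHessian φ A x v w := by
  simp only [twistedHessian, dForm₂, map_neg, _root_.neg_apply]
  ring

variable [CompleteSpace E]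

theorem twistedHessian_invariant {φ : M → ℝ} (hφ : ContMDiff 𝓘(ℝ, E) 𝓘(ℝ, ℝ) ∞ φ)
    {A : M → E →L[ℝ] E} (hs : IsSmoothEnd A) (hi : IsIntegrable A)
    (hA : ∀ x v, A x (A x v) = -v) (x : M) (v w : E) :
    twistedHessian φ A x (A x v) (A x w) = twistedHessian φ A x v w := by
  rw [twistedHessian, chartDeriv_end A, chartDeriv_end A]
  exact dForm₂_invariant (fderiv_fderiv_coordFun_symm hφ x) _ (coordEnd_mul_self hA x)
    (coordEndDeriv_mul_self hs hA x) (hi.nijenhuis_eq_zero hs x) _ _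

theorem twistedHessian_anticommuting {φ : M → ℝ} (hφ : ContMDiff 𝓘(ℝ, E) 𝓘(ℝ, ℝ) ∞ φ)
    {A B C : M → E →L[ℝ] E} (hsA : IsSmoothEnd A) (hsB : IsSmoothEnd B) (hsC : IsSmoothEnd C)
    (hiA : IsIntegrable A) (hiB : IsIntegrable B) (hiC : IsIntegrable C)
    (hA : ∀ x v, A x (A x v) = -v) (hB : ∀ x v, B x (B x v) = -v)
    (hC : ∀ x v, B x (A x v) = C x v) (hAB : ∀ x v, A x (B x v) = -C x v) (x : M) (v w : E) :
    twistedHessian φ A x (B x v) w + twistedHessian φ A x v (B x w) =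
      twistedHessian φ C x (A x v) (A x w) - twistedHessian φ C x v w := by
  have hx := mem_extChartAt_target (I := 𝓘(ℝ, E)) x
  have hAB' : ∀ x v, A x (B x v) = (fun x => -C x) x v := hAB
  simp only [twistedHessian, chartDeriv_end A, chartDeriv_end B]
  refine dForm₂_anticommuting (fderiv_fderiv_coordFun_symm hφ x) _ (coordEnd_mul_self hA x)
    (coordEnd_mul_self hB x) (fun v => (coordEnd_comp hC x hx v).symm)
    (fun v => ?_) (coordEndDeriv_mul_self hsA hA x) (coordEndDeriv_comp hsB hsA hC x)
    (fun u v => ?_) (hiA.nijenhuis_eq_zero hsA x) (hiB.nijenhuis_eq_zero hsB x)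
    (hiC.nijenhuis_eq_zero hsC x) _ _
  · rw [coordEnd_comp hAB' x hx, coordEnd_neg]
  · rw [← coordEndDeriv_comp hsA hsB hAB', coordEndDeriv_neg]

end Twisted

/-! ### Calculus of `2`-forms and the formula for `rho` in degree two. -/

section Two

variable {E : Type*} [NormedAddCommGroup E] [NormedSpace ℝ E]

theorem CForm.two_swap (β : CForm E 2) (v w : E) : β ![w, v] = -β ![v, w] := by
  have h := β.map_swap ![v, w] (i := 0) (j := 1) (by simp)
  refine Eq.trans (congrArg β ?_) h
  ext i
  fin_cases i <;> rfl

theorem CForm.two_add (β : CForm E 2) (u v w : E) : β ![u + v, w] = β ![u, w] + β ![v, w] :=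
  β.toContinuousMultilinearMap.cons_add ![w] u v

theorem CForm.two_neg (β : CForm E 2) (v w : E) : β ![-v, w] = -β ![v, w] := by
  have h := β.two_add v (-v) w
  have h0 : β ![0, w] = 0 := β.map_coord_zero 0 rfl
  rw [add_neg_cancel, h0] at h
  linear_combination -h

theorem CForm.two_sub (β : CForm E 2) (u v w : E) : β ![u - v, w] = β ![u, w] - β ![v, w] := by
  rw [sub_eq_add_neg, two_add, two_neg, sub_eq_add_neg]

theorem CForm.two_add_right (β : CForm E 2) (u v w : E) :
    β ![w, u + v] = β ![w, u] + β ![w, v] := by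
  rw [two_swap, two_add, β.two_swap w u, β.two_swap w v]
  ring

theorem CForm.two_sub_right (β : CForm E 2) (u v w : E) :
    β ![w, u - v] = β ![w, u] - β ![w, v] := by
  rw [two_swap, two_sub, β.two_swap w u, β.two_swap w v]
  ring

theorem CForm.two_ext {β γ : CForm E 2} (h : ∀ v w, β ![v, w] = γ ![v, w]) : β = γ := by
  ext v
  have hv : v = ![v 0, v 1] := by
    ext i
    fin_cases i <;> rfl
  rw [hv]
  exact h _ _

theorem pull_two_apply (A : E →L[ℝ] E) (β : CForm E 2) (v w : E) :
    pull A β ![v, w] = β ![A v, A w] := by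
  refine congrArg β ?_
  ext i
  fin_cases i <;> rfl

namespace QuatStr

variable [FiniteDimensional ℝ E] (H : QuatStr E)

theorem hasWeight_zero_of_invariant {β : CForm E 2} (hβ : ∀ v w, β ![H.I v, H.I w] = β ![v, w]) :
    H.HasWeight 0 β := by
  have h : H.weightProj 0 β = β := CForm.two_ext fun v w => by
    rw [weightProj_zero_apply, hβ]
    ring
  rw [← h]
  exact H.hasWeight_weightProj 0 β

/-- With (1 - J)I = I(1 + J) and the invariance of β, the four terms of the (2,0)-projection combine
in pairs in which everything but the cross terms cancels. -/
theorem rho_two_apply {β : CForm E 2} (hβ : ∀ v w, β ![H.I v, H.I w] = β ![v, w]) (v w : E) :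
    H.rho 2 β ![v, w] = -2⁻¹ * (β ![v, H.J w] + β ![H.J v, w]) +
      2⁻¹ * Complex.I * (β ![v, H.K w] + β ![H.J v, H.I w]) := by
  have hop : ∀ v, H.op 1 0 (-1) 0 v = v - H.J v := fun v => by simp [op, sub_eq_add_neg]
  have hI : ∀ v, H.I v - H.J (H.I v) = H.I (v + H.J v) := fun v => by
    rw [map_add, H.anti, sub_eq_add_neg]
  have hI' : ∀ v w, β ![H.I v, w] = -β ![v, H.I w] := fun v w => by
    rw [← hβ (H.I v), H.I_sq, CForm.two_neg]
  have hK : ∀ w, H.I (w - H.J w) = H.I w + H.K w := fun w => by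
    rw [map_sub, H.anti, sub_neg_eq_add, H.K_eq]
  have hK' : ∀ w, H.I (w + H.J w) = H.I w - H.K w := fun w => by
    rw [map_add, H.anti, ← sub_eq_add_neg, H.K_eq]
  have h : H.rho 2 β ![v, w] =
      H.weightProj 2 (pull (H.op 1 0 (-1) 0) β) ![v, w] := rfl
  rw [h, weightProj_two_apply]
  simp only [pull_two_apply, hop]
  rw [hI, hI, hβ, hI' (v + H.J v), hK, hK']
  simp only [CForm.two_add, CForm.two_sub, CForm.two_add_right, CForm.two_sub_right]
  ring

end QuatStr

end Two

/-! ### The images of ∂∂̄φ and ω_I under `rho`. -/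

section Potential

variable {E : Type*} [NormedAddCommGroup E] [NormedSpace ℝ E] [FiniteDimensional ℝ E]
  {M : Type*} [TopologicalSpace M] [ChartedSpace E M] [IsManifold 𝓘(ℝ, E) ∞ M]

namespace QuatStr

omit [FiniteDimensional ℝ E] in
theorem I_K (H : QuatStr E) (v : E) : H.I (H.K v) = H.J v := by
  rw [H.K_eq, H.anti, H.I_sq, map_neg, neg_neg]

omit [FiniteDimensional ℝ E] in
theorem I_J (H : QuatStr E) (v : E) : H.I (H.J v) = -H.K v := by
  rw [H.K_eq, H.anti]

omit [FiniteDimensional ℝ E] in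
theorem K_I (H : QuatStr E) (v : E) : H.K (H.I v) = -H.J v := by
  rw [H.K_eq, H.I_sq, map_neg]

end QuatStr

namespace HypercomplexStr

variable (X : HypercomplexStr E M) {φ : M → ℝ}

theorem delbar_ofFun_apply (hφ : ContMDiff 𝓘(ℝ, E) 𝓘(ℝ, ℝ) ∞ φ) (z : M) (v : E) :
    X.delbar 0 0 (ofFun E φ) z ![v] = 2⁻¹ * (differential E φ z v : ℂ) +
      2⁻¹ * Complex.I * (differential E φ z ((X.at_ z).I v) : ℂ) := by
  have h := (X.at_ z).weightProj_neg_one_apply (dForm (ofFun E φ) z) v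
  rw [dForm_ofFun_apply hφ, dForm_ofFun_apply hφ] at h
  refine Eq.trans h ?_
  ring

theorem delJ_apply (hφ : ContMDiff 𝓘(ℝ, E) 𝓘(ℝ, ℝ) ∞ φ) (z : M) (v : E) :
    X.delJ φ z ![v] = -2⁻¹ * (differential E φ z ((X.at_ z).J v) : ℂ) +
      2⁻¹ * Complex.I * (differential E φ z ((X.at_ z).K v) : ℂ) := by
  have hv : (fun i => (-(X.at_ z).J) (![v] i)) = ![-(X.at_ z).J v] := by
    ext i
    fin_cases i
    rfl
  refine (congrArg (X.delbar 0 0 (ofFun E φ) z) hv).trans ?_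
  rw [X.delbar_ofFun_apply hφ, map_neg, map_neg, map_neg, QuatStr.I_J, map_neg]
  push_cast
  ring

/-- In ∂̄φ = (dφ + √-1 dφ ∘ I)/2 the first term is closed, and d of the second is already
I-invariant, so the projection changes nothing. -/
theorem delDelbar_apply (hφ : ContMDiff 𝓘(ℝ, E) 𝓘(ℝ, ℝ) ∞ φ) (x : M) (v w : E) :
    X.delDelbar φ x ![v, w] =
      2⁻¹ * Complex.I * (twistedHessian φ (fun x => (X.at_ x).I) x v w : ℂ) := by
  have := FiniteDimensional.complete ℝ E
  have h : ∀ v w, dForm (k := 1) (X.delbar 0 0 (ofFun E φ)) x ![v, w] =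
      2⁻¹ * Complex.I * (twistedHessian φ (fun x => (X.at_ x).I) x v w : ℂ) := fun v w => by
    rw [dForm_apply hφ x (A := fun _ => ContinuousLinearMap.id ℝ E) (B := fun x => (X.at_ x).I)
      (differentiableAt_coordEnd_id x) (differentiableAt_coordEnd X.smooth_I x) 2⁻¹
      (2⁻¹ * Complex.I) (X.delbar_ofFun_apply hφ), twistedHessian_id hφ]
    simp
  have h' := (X.at_ x).weightProj_zero_apply (dForm (k := 1) (X.delbar 0 0 (ofFun E φ)) x) v w
  rw [h, h, twistedHessian_invariant hφ X.smooth_I X.integrable_I (fun x => (X.at_ x).I_sq)] at h'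
  refine Eq.trans h' ?_
  ring

/-- The contribution of J is eliminated, so that only d(dφ ∘ K) has to be compared with ∂∂̄φ. -/
theorem delDelJ_apply (hφ : ContMDiff 𝓘(ℝ, E) 𝓘(ℝ, ℝ) ∞ φ) (x : M) (v w : E) :
    X.delDelJ φ x ![v, w] = 4⁻¹ * Complex.I *
      (twistedHessian φ (fun x => (X.at_ x).K) x v w -
        twistedHessian φ (fun x => (X.at_ x).K) x ((X.at_ x).I v) ((X.at_ x).I w) : ℝ) +
      4⁻¹ * (twistedHessian φ (fun x => (X.at_ x).K) x ((X.at_ x).I v) w +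
        twistedHessian φ (fun x => (X.at_ x).K) x v ((X.at_ x).I w) : ℝ) := by
  have := FiniteDimensional.complete ℝ E
  have h : ∀ v w, dForm (k := 1) (X.delJ φ) x ![v, w] =
      -2⁻¹ * (twistedHessian φ (fun x => (X.at_ x).J) x v w : ℂ) +
      2⁻¹ * Complex.I * (twistedHessian φ (fun x => (X.at_ x).K) x v w : ℂ) := fun v w =>
    dForm_apply hφ x (A := fun x => (X.at_ x).J) (B := fun x => (X.at_ x).K)
      (differentiableAt_coordEnd X.smooth_J x) (differentiableAt_coordEnd X.smooth_K x) (-2⁻¹)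
      (2⁻¹ * Complex.I) (X.delJ_apply hφ) v w
  have h' := (X.at_ x).weightProj_two_apply (dForm (k := 1) (X.delJ φ) x) v w
  rw [h, h, h, h] at h'
  refine Eq.trans h' ?_
  have hJ := twistedHessian_invariant hφ X.smooth_J X.integrable_J (fun x => (X.at_ x).J_sq) x
  -- The triple (K, I, J): it expresses the part of d(dφ ∘ J) not invariant under I through d(dφ ∘
  -- K).
  have hK : ∀ v w, _ := twistedHessian_anticommuting hφ X.smooth_K X.smooth_I X.smooth_J
    X.integrable_K X.integrable_I X.integrable_J (fun x => (X.at_ x).K_sq) (fun x => (X.at_ x).I_sq)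
    (fun x => (X.at_ x).I_K) (fun x => (X.at_ x).K_I) x
  have hK' : ∀ v w, twistedHessian φ (fun x => (X.at_ x).K) x ((X.at_ x).I v) w +
      twistedHessian φ (fun x => (X.at_ x).K) x v ((X.at_ x).I w) =
        twistedHessian φ (fun x => (X.at_ x).J) x ((X.at_ x).I v) ((X.at_ x).I w) -
          twistedHessian φ (fun x => (X.at_ x).J) x v w := fun v w => by
    rw [hK, (X.at_ x).K_eq v, (X.at_ x).K_eq w, hJ]
  have e1 := congrArg (fun r : ℝ => (r : ℂ)) (hK' v w)
  have e2 := congrArg (fun r : ℝ => (r : ℂ)) (hK' ((X.at_ x).I v) w)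
  simp only [(X.at_ x).I_sq, twistedHessian_neg] at e1 e2
  push_cast at e1 e2 ⊢
  linear_combination -8⁻¹ * e1 + 8⁻¹ * Complex.I * e2 - 8⁻¹ * (
    (twistedHessian φ (fun x => (X.at_ x).K) x ((X.at_ x).I v) w : ℂ) +
      (twistedHessian φ (fun x => (X.at_ x).K) x v ((X.at_ x).I w) : ℂ)) * Complex.I_mul_I

theorem delDelbar_invariant (hφ : ContMDiff 𝓘(ℝ, E) 𝓘(ℝ, ℝ) ∞ φ) (x : M) (v w : E) :
    X.delDelbar φ x ![(X.at_ x).I v, (X.at_ x).I w] = X.delDelbar φ x ![v, w] := by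
  have := FiniteDimensional.complete ℝ E
  rw [X.delDelbar_apply hφ, X.delDelbar_apply hφ,
    twistedHessian_invariant hφ X.smooth_I X.integrable_I (fun x => (X.at_ x).I_sq)]

/-- The relation for the triple (I, J, K) turns the values of d(dφ ∘ I) on arguments moved by J into
d(dφ ∘ K). Taken at (v, w) it gives the imaginary part, at (Iv, w) the real part. -/
theorem rho_delDelbar (hφ : ContMDiff 𝓘(ℝ, E) 𝓘(ℝ, ℝ) ∞ φ) (x : M) :
    (X.at_ x).rho 2 (X.delDelbar φ x) = X.delDelJ φ x := by
  have := FiniteDimensional.complete ℝ E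
  refine CForm.two_ext fun v w => ?_
  rw [QuatStr.rho_two_apply _ (X.delDelbar_invariant hφ x), X.delDelJ_apply hφ]
  have hI := twistedHessian_invariant hφ X.smooth_I X.integrable_I (fun x => (X.at_ x).I_sq) x
  have hA : ∀ v w, _ := twistedHessian_anticommuting hφ X.smooth_I X.smooth_J X.smooth_K
    X.integrable_I X.integrable_J X.integrable_K (fun x => (X.at_ x).I_sq) (fun x => (X.at_ x).J_sq)
    (fun x v => ((X.at_ x).K_eq v).symm) (fun x => (X.at_ x).I_J) x
  have e1 := congrArg (fun r : ℝ => (r : ℂ)) (hA v w)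
  have e2 := congrArg (fun r : ℝ => (r : ℂ)) (hA ((X.at_ x).I v) w)
  rw [(X.at_ x).I_sq, twistedHessian_neg, ← (X.at_ x).K_eq v, ← hI ((X.at_ x).K v),
    (X.at_ x).I_K] at e2
  rw [X.delDelbar_apply hφ, X.delDelbar_apply hφ, X.delDelbar_apply hφ, X.delDelbar_apply hφ,
    ← hI v ((X.at_ x).K w), (X.at_ x).I_K]
  push_cast at e1 e2 ⊢
  linear_combination -(4⁻¹ * Complex.I) * e1 + 4⁻¹ * Complex.I ^ 2 * e2 - 4⁻¹ * (
    (twistedHessian φ (fun x => (X.at_ x).K) x ((X.at_ x).I v) w : ℂ) +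
      (twistedHessian φ (fun x => (X.at_ x).K) x v ((X.at_ x).I w) : ℂ)) * Complex.I_mul_I

end HypercomplexStr

/-! ### The fundamental forms of the metric. -/

namespace QuatHermitianMetric

variable {X : HypercomplexStr E M} (g : QuatHermitianMetric X)

omit [FiniteDimensional ℝ E]

theorem at_I_I (x : M) (v w : E) : g.at_ x ((X.at_ x).I v) ((X.at_ x).I w) = g.at_ x v w := by
  have h : (X.at_ x).op 0 1 0 0 = (X.at_ x).I := by simp [QuatStr.op]
  rw [← h]
  exact g.invariant x 0 1 0 0 (by norm_num) v w

theorem at_J_left (x : M) (v w : E) : g.at_ x ((X.at_ x).J v) w = -g.at_ x v ((X.at_ x).J w) := by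
  have h : (X.at_ x).op 0 0 1 0 = (X.at_ x).J := by simp [QuatStr.op]
  have hJ : g.at_ x ((X.at_ x).J v) ((X.at_ x).J ((X.at_ x).J w)) = g.at_ x v ((X.at_ x).J w) := by
    rw [← h]
    exact g.invariant x 0 0 1 0 (by norm_num) v _
  rw [← hJ, (X.at_ x).J_sq, map_neg, neg_neg]

theorem omegaI_apply (x : M) (v w : E) : g.omegaI x ![v, w] = (g.at_ x v ((X.at_ x).I w) : ℂ) := rfl

theorem Omega_apply (x : M) (v w : E) :
    g.Omega x ![v, w] = -(g.at_ x v ((X.at_ x).J w) : ℂ) +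
      Complex.I * (g.at_ x v ((X.at_ x).K w) : ℂ) := rfl

theorem omegaI_invariant (x : M) (v w : E) :
    g.omegaI x ![(X.at_ x).I v, (X.at_ x).I w] = g.omegaI x ![v, w] := by
  rw [omegaI_apply, omegaI_apply, at_I_I]

theorem rho_omegaI [FiniteDimensional ℝ E] (x : M) :
    (X.at_ x).rho 2 (g.omegaI x) = (-Complex.I) • g.Omega x := by
  refine CForm.two_ext fun v w => ?_
  rw [QuatStr.rho_two_apply _ (g.omegaI_invariant x), ContinuousAlternatingMap.smul_apply,
    Omega_apply, smul_eq_mul]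
  simp only [omegaI_apply, at_J_left, QuatStr.I_J, QuatStr.I_K, (X.at_ x).I_sq, map_neg,
    ← (X.at_ x).K_eq]
  push_cast
  linear_combination (g.at_ x v ((X.at_ x).K w) : ℂ) * Complex.I_mul_I

end QuatHermitianMetric

end Potential

theorem real_smul_form {E : Type*} [NormedAddCommGroup E] [NormedSpace ℝ E] {k : ℕ} (r : ℝ)
    (ξ : CForm E k) : r • ξ = (r : ℂ) • ξ := by
  ext v
  exact Complex.real_smul

end HKT

end

/-! ### The equivalence of the two equations. -/

theorem mainTheorem4 {n : ℕ}
    {E : Type*} [NormedAddCommGroup E] [NormedSpace ℝ E] [FiniteDimensional ℝ E]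
    (hE : Module.finrank ℝ E = 4 * n)
    {M : Type*} [TopologicalSpace M] [ChartedSpace E M] [IsManifold 𝓘(ℝ, E) ∞ M]
    (X : HKT.HypercomplexStr E M) (g : HKT.QuatHermitianMetric X) (hg : g.IsHKT)
    (Θ : HKT.DForm E M (2 * n)) (hΘ : X.IsHolomorphic Θ) (hΘ0 : ∀ x, Θ x ≠ 0)
    (hΘreal : ∀ x, (X.at_ x).IsQReal (Θ x)) (hΘpos : ∀ x, (X.at_ x).IsQPos n (Θ x))
    (f φ : M → ℝ) (hf : ContMDiff 𝓘(ℝ, E) 𝓘(ℝ, ℝ) ∞ f) (hφ : ContMDiff 𝓘(ℝ, E) 𝓘(ℝ, ℝ) ∞ φ) :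
    (∀ x, HKT.wpow (g.Omega x + X.delDelJ φ x) n
        = Real.exp (f x) • HKT.wpow (g.Omega x) n) ↔
    (∀ x, HKT.wedge (HKT.wpow (g.omegaI x - Complex.I • X.delDelbar φ x) n) (X.Phi Θ x)
        = Real.exp (f x) • HKT.wedge (HKT.wpow (g.omegaI x) n) (X.Phi Θ x)) := by
  refine forall_congr' fun x => ?_
  have hT : (X.at_ x).IsType (2 * n) 0 (Θ x) := hΘ.2.1 x
  have hV : ∃ v, (X.at_ x).IsV (n := n) (p := 0) (Nat.zero_le n) (Θ x) (HKT.const0 E 1) v :=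
    (X.at_ x).exists_isV_one hE hT
  have hΦ : (X.at_ x).IsV (n := n) (p := 0) (Nat.zero_le n) (Θ x) (HKT.const0 E 1)
      (X.Phi Θ x) := by
    -- Existence excludes the default value 0. Of the chosen form only the defining property of V(1)
    -- is used.
    have h : X.Phi Θ x = hV.choose := dif_pos hV
    rw [h]
    exact hV.choose_spec
  have hω : (X.at_ x).HasWeight 0 (g.omegaI x) :=
    (X.at_ x).hasWeight_zero_of_invariant (g.omegaI_invariant x)
  have hω' : (X.at_ x).HasWeight 0 (g.omegaI x - Complex.I • X.delDelbar φ x) :=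
    (X.at_ x).hasWeight_zero_of_invariant fun v w => by
      simp only [ContinuousAlternatingMap.sub_apply, ContinuousAlternatingMap.smul_apply,
        g.omegaI_invariant, X.delDelbar_invariant hφ]
  have hρ : (X.at_ x).rho 2 (g.omegaI x - Complex.I • X.delDelbar φ x) =
      (-Complex.I) • (g.Omega x + X.delDelJ φ x) := by
    rw [map_sub, map_smul, g.rho_omegaI, X.rho_delDelbar hφ]
    module
  rw [HKT.real_smul_form, HKT.real_smul_form]
  exact (X.at_ x).wpow_eq_smul_iff hE hT (hΘ0 x) hΦ hω hω' (g.rho_omegaI x) hρ _
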